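/- **Setting.** Let $\mathcal L$ be a finite set of lines in $\mathbb{CP}^2$, regarded as planes through the origin in $\mathbb C^3$, and let $\mathbb K$ be a field of characteristic zero. Let $\mathcal E$ be the exterior algebra over $\mathbb K$ on generators $e_\ell$ ($\ell\in\mathcal L$), with $\partial(e_{\ell_1}\cdots e_{\ell_p})=\sum_{j=1}^p(-1)^{j-1}e_{\ell_1}\cdots\widehat{e_{\ell_j}}\cdots e_{\ell_p}$, and let $A=\mathcal E/\mathcal I$ be the Orlik–Solomon algebra, where $\mathcal I$ is the ideal generated by all $\partial(e_{\ell_1}\cdots e_{\ell_p})$ with $\{\ell_1,\dots,\ell_p\}$ a minimal dependent set of $p$ planes (dependent: the intersection has codimension less than $p$). The images $\omega_\ell$ of the $e_\ell$ form a basis of $A^1$, which is thereby identified with $\mathbb K^{\mathcal L}$. The resonance variety $\mathcal R^1(\mathcal L)$ is the set of $a\in A^1$ such that $ab=0$ for some $b\in A^1\setminus\mathbb K a$. A *global resonance component* is an irreducible component $R$ of $\mathcal R^1(\mathcal L)$ (in the Zariski topology of $A^1\cong\mathbb K^{\mathcal L}$) that is contained in no coordinate hyperplane $\{a_\ell=0\}$;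 its dimension is its Krull dimension. For a positive integer $d$, a *$(k,d)$-multinet* on $\mathcal L$ with multiplicities $m:\mathcal L\to\mathbb Z_{>0}$ is a partition of $\mathcal L$ into $k\ge 3$ nonempty classes $\mathcal L_1,\dots,\mathcal L_k$ together with a set $\mathcal X$ of points, each lying on at least three lines of $\mathcal L$, such that 1. $\sum_{\ell\in\mathcal L_i}m(\ell)=d$ for every $i$; 2. if $\ell\in\mathcal L_i$ and $\ell'\in\mathcal L_j$ with $i\ne j$, then $\ell\cap\ell'\in\mathcal X$; 3. for each $p\in\mathcal X$, the sum $\sum_{\ell\in\mathcal L_i,\,p\in\ell}m(\ell)$ does not depend on $i$; 4. for any $\ell,\ell'$ in the same class there is a sequence $\ell=\ell_0,\ell_1,\dots,\ell_r=\ell'$ in $\mathcal L$ with $\ell_{j-1}\cap\ell_j\notin\mathcal X$ for $1\le j\le r$. **Theorem 2.5.** Suppose $\mathcal L$ supports a global resonance component $R$ of dimension $k-1$. Then, for some $d$, $\mathcal L$ supports a $(k,d)$-multinet. Moreover, the multinet can be chosen with $\gcd\{m(\ell):\ell\in\mathcal L\}=1$ and with the following properties. Let $J$ be the $\mathcal X\times\mathcal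 L$ incidence matrix, $E$ the $\mathcal L\times\mathcal L$ matrix of all ones, and $Q=J^{T}J-E$. Then $R=\ker Q\cap\ker E$ (kernels in $\mathbb K^{\mathcal L}$). The matrix $Q$ is the direct sum of its diagonal blocks $Q_1,\dots,Q_k$ on the classes $\mathcal L_1,\dots,\mathcal L_k$. Each $Q_i$ is an indecomposable generalized Cartan matrix of affine type: its off-diagonal entries are $\le 0$ (with $q_{\ell\ell'}=0$ implying $q_{\ell'\ell}=0$), its real kernel is one-dimensional and contains a vector with all coordinates positive, and for real $v$, $Q_iv\ge0$ implies $Q_iv=0$. The real kernel of $Q_i$ is spanned by the positive integer vector $u_i=(m(\ell))_{\ell\in\mathcal L_i}$, and all the $u_i$ have the same coordinate sum $d$. -/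

import Mathlib

open scoped LinearAlgebra.Projectivization

noncomputable section

/-! ### Line arrangements in the complex projective plane -/

/-- A finite arrangement of (distinct) lines in the complex projective plane. A line is given by
the corresponding plane through the origin in `ℂ³`. -/
structure LineArrangement where
  lines : Finset (Submodule ℂ (Fin 3 → ℂ))
  finrank_eq_two : ∀ H ∈ lines, Module.finrank ℂ H = 2

namespace LineArrangement

variable (L : LineArrangement)

/-- The type of lines of the arrangement. -/
abbrev Line : Type := {H : Submodule ℂ (Fin 3 → ℂ) // H ∈ L.lines}

instance : Fintype L.Line := inferInstanceAs (Fintype {H // H ∈ L.lines})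

instance : DecidableEq L.Line := Classical.decEq _

variable {L}

/-- The point `p` of the projective plane lies on the line `ℓ`. -/
def Line.HasPoint (ℓ : L.Line) (p : ℙ ℂ (Fin 3 → ℂ)) : Prop :=
  p.submodule ≤ ℓ.1

variable (L)

/-- A multiple point: a point that lies on at least three lines of the arrangement. -/
def IsMultiplePoint (p : ℙ ℂ (Fin 3 → ℂ)) : Prop :=
  3 ≤ {ℓ : L.Line | ℓ.HasPoint p}.ncard

/-! ### The Orlik-Solomon algebra -/

/-- A set of planes in `ℂ³` is dependent when the codimension of its intersection is smaller than
its cardinality (that is, when the defining linear forms are linearly dependent). -/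
def Dependent (S : Finset L.Line) : Prop :=
  Module.finrank ℂ ((Fin 3 → ℂ) ⧸ S.inf (fun ℓ => ℓ.1)) < S.card

/-- Minimal dependent sets of planes. -/
def IsCircuit (S : Finset L.Line) : Prop := Minimal L.Dependent S

variable (K : Type*) [Field K]

/-- The exterior algebra on generators `e_ℓ`, one for each line. -/
abbrev Ext : Type _ := ExteriorAlgebra K (L.Line → K)

/-- The generator `e_ℓ`. -/
def e (ℓ : L.Line) : L.Ext K := ExteriorAlgebra.ι K (Pi.single ℓ 1)

/-- The boundary map of the exterior algebra: contraction with the linear functional that takes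
the value `1` on every generator. Its effect on monomials is `boundary_prod`. -/
def boundary : L.Ext K →ₗ[K] L.Ext K :=
  CliffordAlgebra.contractLeft (Q := 0) (∑ ℓ : L.Line, LinearMap.proj ℓ)

/-- `∂ (e_{i₀} ⋯ e_{i_p}) = ∑ₖ (-1)ᵏ e_{i₀} ⋯ (omit k) ⋯ e_{i_p}`. -/
theorem boundary_prod {p : ℕ} (i : Fin (p + 1) → L.Line) :
    L.boundary K (List.ofFn fun j => L.e K (i j)).prod =
      ∑ k : Fin (p + 1), (-1 : K) ^ (k : ℕ) •
        (List.ofFn fun j : Fin p => L.e K (i (k.succAbove j))).prod := by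
  have step : ∀ (ℓ : L.Line) (x : L.Ext K),
      L.boundary K (L.e K ℓ * x) = x - L.e K ℓ * L.boundary K x := by
    intro ℓ x
    have h := CliffordAlgebra.contractLeft_ι_mul (Q := (0 : QuadraticForm K (L.Line → K)))
      (∑ ℓ : L.Line, LinearMap.proj ℓ) (Pi.single ℓ (1 : K)) x
    have h1 : (∑ ℓ : L.Line, LinearMap.proj ℓ : Module.Dual K (L.Line → K))
        (Pi.single ℓ (1 : K)) = 1 := by
      simp [LinearMap.sum_apply]
    rw [h1, one_smul] at h
    exact h
  induction p with
  | zero =>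
    have h := step (i 0) 1
    have h1 : L.boundary K 1 = 0 := CliffordAlgebra.contractLeft_one _ _
    rw [h1] at h
    simpa using h
  | succ p ih =>
    rw [List.ofFn_succ, List.prod_cons, step, ih, Fin.sum_univ_succ (n := p + 1)]
    simp only [Fin.val_zero, pow_zero, one_smul, Fin.succAbove_zero]
    rw [sub_eq_add_neg, Finset.mul_sum, ← Finset.sum_neg_distrib]
    congr 1
    refine Finset.sum_congr rfl fun k _ => ?_
    rw [List.ofFn_succ (n := p), List.prod_cons]
    simp [pow_succ, Fin.succ_succAbove_succ]

/-- The relations of the Orlik-Solomon algebra: `∂ (e_{i₁} ⋯ e_{i_p}) = 0` whenever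
`{i₁, …, i_p}` is a minimal dependent set with `p` elements. -/
inductive OSRel : L.Ext K → L.Ext K → Prop
  | circuit {p : ℕ} (i : Fin p ↪ L.Line) (hi : L.IsCircuit (Finset.univ.map i)) :
      OSRel (L.boundary K (List.ofFn fun j => L.e K (i j)).prod) 0

/-- The Orlik-Solomon algebra over `K`: the quotient of the exterior algebra by the two-sided
ideal generated by the boundaries of the minimal dependent sets. -/
abbrev OrlikSolomon : Type _ := RingQuot (L.OSRel K)

/-- The degree-one element `∑ a_ℓ ω_ℓ` of the Orlik-Solomon algebra with coefficients `a`. As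
`omega_injective` shows, this identifies `K ^ L` with the degree-one part `A¹`, in such a way that
the standard basis goes to the basis `(ω_ℓ)` of `A¹`. -/
def omega : (L.Line → K) →ₗ[K] L.OrlikSolomon K :=
  (RingQuot.mkAlgHom K (L.OSRel K)).toLinearMap ∘ₗ ExteriorAlgebra.ι K

/-- A dependent set of distinct planes has at least three elements. -/
theorem three_le_card_of_dependent {S : Finset L.Line} (hS : L.Dependent S) : 3 ≤ S.card := by
  have hrk : ∀ H : Submodule ℂ (Fin 3 → ℂ),
      Module.finrank ℂ ((Fin 3 → ℂ) ⧸ H) + Module.finrank ℂ H = 3 := fun H => by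
    simpa using H.finrank_quotient_add_finrank
  by_contra hlt
  have hcard : S.card = 0 ∨ S.card = 1 ∨ S.card = 2 := by omega
  rw [Dependent] at hS
  rcases hcard with h | h | h
  · omega
  · obtain ⟨ℓ, rfl⟩ := Finset.card_eq_one.1 h
    rw [Finset.inf_singleton] at hS
    have h1 := hrk ℓ.1
    have h2 := L.finrank_eq_two ℓ.1 ℓ.2
    omega
  · obtain ⟨ℓ, ℓ', hne, rfl⟩ := Finset.card_eq_two.1 h
    rw [Finset.inf_insert, Finset.inf_singleton] at hS
    have h1 := hrk (ℓ.1 ⊓ ℓ'.1)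
    have h2 := L.finrank_eq_two ℓ.1 ℓ.2
    have h3 := L.finrank_eq_two ℓ'.1 ℓ'.2
    have hle : Module.finrank ℂ ↥(ℓ.1 ⊓ ℓ'.1) ≤ 2 := h2 ▸ Submodule.finrank_mono inf_le_left
    have h4 : Module.finrank ℂ ↥(ℓ.1 ⊓ ℓ'.1) = 2 := by omega
    have h5 : ℓ.1 ⊓ ℓ'.1 = ℓ.1 := Submodule.eq_of_le_of_finrank_eq inf_le_left (by omega)
    have h6 : ℓ.1 ⊓ ℓ'.1 = ℓ'.1 := Submodule.eq_of_le_of_finrank_eq inf_le_right (by omega)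
    exact hne (Subtype.ext (h5.symm.trans h6))

theorem omega_injective : Function.Injective (L.omega K) := by
  let φ : L.Ext K →ₐ[K] TrivSqZeroExt K (L.Line → K) := ExteriorAlgebra.toTrivSqZeroExt
  have hφ : ∀ ℓ, φ (L.e K ℓ) = TrivSqZeroExt.inr (Pi.single ℓ 1) := fun ℓ =>
    ExteriorAlgebra.toTrivSqZeroExt_ι _
  have hrel : ∀ ⦃x y : L.Ext K⦄, L.OSRel K x y → φ x = φ y := by
    rintro _ _ ⟨i, hi⟩
    rename_i p
    have hp : 3 ≤ p := by simpa using L.three_le_card_of_dependent hi.prop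
    obtain ⟨q, rfl⟩ : ∃ q, p = q + 2 + 1 := ⟨p - 3, by omega⟩
    rw [boundary_prod, map_sum, map_zero]
    refine Finset.sum_eq_zero fun k _ => ?_
    rw [map_smul, List.ofFn_succ, List.ofFn_succ, List.prod_cons, List.prod_cons, ← mul_assoc,
      map_mul, map_mul, hφ, hφ, TrivSqZeroExt.inr_mul_inr, zero_mul, smul_zero]
  intro a b hab
  have h := congrArg (RingQuot.liftAlgHom K ⟨φ, hrel⟩) hab
  simp only [omega, LinearMap.comp_apply, AlgHom.toLinearMap_apply,
    RingQuot.liftAlgHom_mkAlgHom_apply] at h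
  exact TrivSqZeroExt.inr_injective
    ((ExteriorAlgebra.toTrivSqZeroExt_ι a).symm.trans
      (h.trans (ExteriorAlgebra.toTrivSqZeroExt_ι b)))

/-! ### Resonance -/

/-- The degree-one resonance variety, as a set of coefficient vectors: those `a` such that
`∑ a_ℓ ω_ℓ` annihilates some element of `A¹` that is not a scalar multiple of it. -/
def resonance : Set (L.Line → K) :=
  {a | ∃ b : L.Line → K, b ∉ Submodule.span K {a} ∧ L.omega K a * L.omega K b = 0}

end LineArrangement

/-- The Zariski topology on `K ^ ι`: closed sets are the common zero sets of polynomials. -/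
@[reducible] def zariskiTopology (ι K : Type*) [Field K] : TopologicalSpace (ι → K) :=
  TopologicalSpace.ofClosed
    {Z | ∃ S : Set (MvPolynomial ι K), Z = {x | ∀ f ∈ S, MvPolynomial.eval x f = 0}}
    ⟨{1}, by simp⟩
    (by
      intro A hA
      refine ⟨{f | ∃ Z ∈ A, ∀ x ∈ Z, MvPolynomial.eval x f = 0}, ?_⟩
      ext x
      constructor
      · rintro hx f ⟨Z, hZ, hf⟩
        exact hf x (hx Z hZ)
      · intro hx Z hZ
        obtain ⟨S, rfl⟩ := hA hZ
        exact fun f hf => hx f ⟨_, hZ, fun y hy => hy f hf⟩)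
    (by
      rintro _ ⟨S, rfl⟩ _ ⟨T, rfl⟩
      refine ⟨{h | ∃ f ∈ S, ∃ g ∈ T, h = f * g}, ?_⟩
      ext x
      constructor
      · rintro (hx | hx) _ ⟨f, hf, g, hg, rfl⟩
        · simp [hx f hf]
        · simp [hx g hg]
      · intro hx
        by_contra hcon
        simp only [Set.mem_union, Set.mem_ofPred_eq, not_or, not_forall] at hcon
        obtain ⟨⟨f, hf, hf0⟩, ⟨g, hg, hg0⟩⟩ := hcon
        have := hx _ ⟨f, hf, g, hg, rfl⟩
        rw [map_mul, mul_eq_zero] at this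
        exact this.elim hf0 hg0)

/-- `R` is an irreducible component of `V ⊆ K ^ ι` in the Zariski topology: a maximal irreducible
subset of `V`. -/
def IsZariskiComponent {ι K : Type*} [Field K] (V R : Set (ι → K)) : Prop :=
  letI := zariskiTopology ι K
  Maximal (fun Z : Set (ι → K) => IsIrreducible Z ∧ Z ⊆ V) R

/-- The (Krull) dimension of a subset of `K ^ ι` in the Zariski topology. -/
def zariskiDim {ι K : Type*} [Field K] (R : Set (ι → K)) : WithBot ℕ∞ :=
  letI := zariskiTopology ι K
  topologicalKrullDim R

namespace LineArrangement

variable (L : LineArrangement)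

/-- A global resonance component: an irreducible component of the resonance variety that is
contained in no coordinate hyperplane. -/
structure IsGlobalResonanceComponent (K : Type*) [Field K] (R : Set (L.Line → K)) : Prop where
  isComponent : IsZariskiComponent (L.resonance K) R
  not_subset_hyperplane : ∀ ℓ : L.Line, ¬ R ⊆ {a | a ℓ = 0}

/-! ### Multinets -/

variable {L}

/-- The intersection point of the distinct lines `ℓ` and `ℓ'` belongs to `X`. -/
def MeetIn (X : Finset (ℙ ℂ (Fin 3 → ℂ))) (ℓ ℓ' : L.Line) : Prop :=
  ∃ p ∈ X, ℓ.HasPoint p ∧ ℓ'.HasPoint p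

open Classical in
/-- A weak `(k,d)`-multinet on the multi-arrangement `(L, m)`, with classes the (nonempty) fibres
of `c` and with base locus `X`. -/
structure IsWeakMultinet (k d : ℕ) (m : L.Line → ℕ+) (c : L.Line → Fin k)
    (X : Finset (ℙ ℂ (Fin 3 → ℂ))) : Prop where
  three_le : 3 ≤ k
  classes_nonempty : Function.Surjective c
  isMultiplePoint : ∀ p ∈ X, L.IsMultiplePoint p
  sum_class : ∀ i, ∑ ℓ with c ℓ = i, (m ℓ : ℕ) = d
  meetIn : ∀ ℓ ℓ', c ℓ ≠ c ℓ' → MeetIn X ℓ ℓ'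
  sum_point : ∀ p ∈ X, ∀ i j,
    ∑ ℓ with c ℓ = i ∧ ℓ.HasPoint p, (m ℓ : ℕ) = ∑ ℓ with c ℓ = j ∧ ℓ.HasPoint p, (m ℓ : ℕ)

/-- A `(k,d)`-multinet: a weak multinet in which any two lines of a class are joined by a sequence
of lines of the arrangement whose successive members meet outside the base locus. -/
structure IsMultinet (k d : ℕ) (m : L.Line → ℕ+) (c : L.Line → Fin k)
    (X : Finset (ℙ ℂ (Fin 3 → ℂ))) : Prop extends IsWeakMultinet k d m c X where
  connected : ∀ ℓ ℓ', c ℓ = c ℓ' →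
    Relation.ReflTransGen (fun ℓ₁ ℓ₂ : L.Line => ¬ MeetIn X ℓ₁ ℓ₂) ℓ ℓ'

/-! ### The generalized Cartan matrix of a set of points -/

variable (L)

open Classical in
/-- The incidence matrix `J` of a set of points. -/
def incidence (X : Finset (ℙ ℂ (Fin 3 → ℂ))) : Matrix X L.Line ℤ :=
  Matrix.of fun p ℓ => if ℓ.HasPoint p.1 then 1 else 0

/-- The matrix `Q = Jᵀ J - E`, where `E` is the matrix of all ones. -/
def cartan (X : Finset (ℙ ℂ (Fin 3 → ℂ))) : Matrix L.Line L.Line ℤ :=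
  (L.incidence X).transpose * L.incidence X - Matrix.of fun _ _ => 1

variable {L}

/-- The diagonal block of `Q`, with real entries, on the `i`-th class of the partition `c`. -/
def cartanBlock (X : Finset (ℙ ℂ (Fin 3 → ℂ))) {k : ℕ} (c : L.Line → Fin k) (i : Fin k) :
    Matrix {ℓ // c ℓ = i} {ℓ // c ℓ = i} ℝ :=
  Matrix.of fun ℓ ℓ' => (L.cartan X ℓ.1 ℓ'.1 : ℝ)

end LineArrangement

/-- An indecomposable generalized Cartan matrix of affine type, in the sense of Vinberg's
classification. -/
structure IsAffineCartan {ι : Type*} [Fintype ι] (A : Matrix ι ι ℝ) : Prop where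
  nonpos : ∀ i j, i ≠ j → A i j ≤ 0
  zero_symm : ∀ i j, A i j = 0 → A j i = 0
  indecomposable : ∀ S : Set ι, S.Nonempty → Sᶜ.Nonempty → ∃ i ∈ S, ∃ j ∈ Sᶜ, A i j ≠ 0
  corank_one : Module.finrank ℝ (LinearMap.ker A.mulVecLin) = 1
  exists_pos : ∃ u : ι → ℝ, (∀ i, 0 < u i) ∧ A.mulVec u = 0
  eq_zero_of_nonneg : ∀ v : ι → ℝ, (∀ i, 0 ≤ A.mulVec v i) → A.mulVec v = 0

end

noncomputable section

/-! ### Points and lines -/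

namespace LineArrangement

variable {L : LineArrangement}

/-! Write `s_p(a)` for the sum of the coefficients of `a` over the lines through `p`. Products in
degree one are decided point by point: `ab = 0` exactly when `s_p(a) b_ℓ = s_p(b) a_ℓ` for every
line `ℓ` through every point `p` (`eq_of_omega_mul_omega_eq_zero`, `omega_mul_omega_eq_zero`).

Let `a` be resonant with all coordinates nonzero, with partner `b`, and let `X` be the set of
multiple points with `s_p(a) = 0`. The ratio `b/a` agrees on two lines that meet outside `X`, so it
is constant on the components of that relation; these are the classes, and also the indecomposable
blocks of `Q`. Since `Ja = Jb = 0`, `Q` acts on `a` and `b` as `-E`; comparing blocks, and using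
that `b` is not a multiple of `a`, gives `Ea = Eb = 0`, hence `Qa = Qb = 0`
(`mem_cartanKer_of_resonant`).

So every block is singular, over `ℚ` as well, by applying `ℚ`-linear functionals `K → ℚ` to `a`.
Taking absolute values does not increase the form of `Q`. Thus each block carries a nonnegative
vector of sum 1 with nonpositive form. For two such vectors `x`, `y` on different blocks, the form
at `x - y` is nonpositive, but it equals `|J(x - y)|²` because `E(x - y) = 0`. Hence `Jx = Jy` and
`Qx = 0`. Connectedness makes `x` positive on its block, and `Jx = Jy` is the multinet condition at
the points of `X` (`exists_pos_mulVec_eq_zero`). Clearing denominators gives `m`; affine type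
follows from the positive kernel vector.

Consequently `ker Q ∩ ker E` consists of the vectors `r_i m` on class `i` with `∑ r_i = 0`. Any two
of them multiply to zero, so this space lies in the resonance variety. Only finitely many `X` occur,
so an irreducible component in no coordinate hyperplane lies in one such space, and equals it by
maximality. Its dimension is the number of classes minus one, and at least 2. -/

theorem exists_projectivization_le {W : Submodule ℂ (Fin 3 → ℂ)} (hW : W ≠ ⊥) :
    ∃ p : ℙ ℂ (Fin 3 → ℂ), p.submodule ≤ W := by
  obtain ⟨v, hv, hv0⟩ := Submodule.exists_mem_ne_zero_of_ne_bot hW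
  refine ⟨Projectivization.mk ℂ v hv0, ?_⟩
  rw [Projectivization.submodule_mk, Submodule.span_singleton_le_iff_mem]
  exact hv

theorem finrank_inf_eq_one {ℓ ℓ' : L.Line} (h : ℓ ≠ ℓ') :
    Module.finrank ℂ ↥(ℓ.1 ⊓ ℓ'.1) = 1 := by
  have h2 := L.finrank_eq_two ℓ.1 ℓ.2
  have h3 := L.finrank_eq_two ℓ'.1 ℓ'.2
  have h1 := Submodule.finrank_sup_add_finrank_inf_eq ℓ.1 ℓ'.1
  have hs : Module.finrank ℂ ↥(ℓ.1 ⊔ ℓ'.1) ≤ 3 := by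
    simpa using Submodule.finrank_le (ℓ.1 ⊔ ℓ'.1)
  have hle : Module.finrank ℂ ↥(ℓ.1 ⊓ ℓ'.1) ≤ 2 := h2 ▸ Submodule.finrank_mono inf_le_left
  by_contra hne
  have h4 : Module.finrank ℂ ↥(ℓ.1 ⊓ ℓ'.1) = 2 := by omega
  have h5 : ℓ.1 ⊓ ℓ'.1 = ℓ.1 := Submodule.eq_of_le_of_finrank_eq inf_le_left (by omega)
  have h6 : ℓ.1 ⊓ ℓ'.1 = ℓ'.1 := Submodule.eq_of_le_of_finrank_eq inf_le_right (by omega)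
  exact h (Subtype.ext (h5.symm.trans h6))

theorem exists_hasPoint {ℓ ℓ' : L.Line} (h : ℓ ≠ ℓ') : ∃ p, ℓ.HasPoint p ∧ ℓ'.HasPoint p := by
  have hne : ℓ.1 ⊓ ℓ'.1 ≠ ⊥ := by
    intro hb
    have := finrank_inf_eq_one h
    rw [hb, finrank_bot] at this
    exact zero_ne_one this
  obtain ⟨p, hp⟩ := exists_projectivization_le hne
  exact ⟨p, hp.trans inf_le_left, hp.trans inf_le_right⟩

theorem hasPoint_unique {ℓ ℓ' : L.Line} (h : ℓ ≠ ℓ') {p q : ℙ ℂ (Fin 3 → ℂ)}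
    (hp : ℓ.HasPoint p) (hp' : ℓ'.HasPoint p) (hq : ℓ.HasPoint q) (hq' : ℓ'.HasPoint q) :
    p = q := by
  have key : ∀ r : ℙ ℂ (Fin 3 → ℂ), ℓ.HasPoint r → ℓ'.HasPoint r → r.submodule = ℓ.1 ⊓ ℓ'.1 :=
    fun r hr hr' => Submodule.eq_of_le_of_finrank_eq (le_inf hr hr')
      (by rw [finrank_inf_eq_one h, r.finrank_submodule])
  exact Projectivization.submodule_injective ((key p hp hp').trans (key q hq hq').symm)

theorem dependent_of_hasPoint {S : Finset L.Line} (hS : 3 ≤ S.card) {p : ℙ ℂ (Fin 3 → ℂ)}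
    (hp : ∀ ℓ ∈ S, ℓ.HasPoint p) : L.Dependent S := by
  have h1 : p.submodule ≤ S.inf (fun ℓ => ℓ.1) := Finset.le_inf hp
  have h2 := Submodule.finrank_mono h1
  rw [p.finrank_submodule] at h2
  have h3 := (S.inf (fun ℓ => ℓ.1)).finrank_quotient_add_finrank
  rw [Module.finrank_fin_fun] at h3
  rw [Dependent]
  omega

theorem isCircuit_of_hasPoint {S : Finset L.Line} (hS : S.card = 3) {p : ℙ ℂ (Fin 3 → ℂ)}
    (hp : ∀ ℓ ∈ S, ℓ.HasPoint p) : L.IsCircuit S := by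
  refine ⟨dependent_of_hasPoint hS.ge hp, fun T hT hTS => ?_⟩
  exact (Finset.eq_of_subset_of_card_le hTS
    (hS.le.trans (L.three_le_card_of_dependent hT))).ge

theorem exists_hasPoint_of_dependent {S : Finset L.Line} (hS : S.card = 3) (h : L.Dependent S) :
    ∃ p, ∀ ℓ ∈ S, ℓ.HasPoint p := by
  have hne : S.inf (fun ℓ => ℓ.1) ≠ ⊥ := by
    intro hb
    have h3 := (S.inf (fun ℓ => ℓ.1)).finrank_quotient_add_finrank
    rw [Module.finrank_fin_fun] at h3
    rw [Dependent] at h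
    have h4 : Module.finrank ℂ ↥(S.inf (fun ℓ => ℓ.1)) = 0 := by rw [hb, finrank_bot]
    omega
  obtain ⟨p, hp⟩ := exists_projectivization_le hne
  exact ⟨p, fun ℓ hℓ => hp.trans (Finset.inf_le hℓ)⟩

/-! ### Multiplication in degree one -/

variable (K : Type*) [Field K]

open Classical in
/-- The part of a degree-one element supported on the lines through `p`. -/
def atPoint (p : ℙ ℂ (Fin 3 → ℂ)) : (L.Line → K) →ₗ[K] (L.Line → K) :=
  LinearMap.pi fun ℓ => if ℓ.HasPoint p then LinearMap.proj ℓ else 0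

/-- The sum of the coefficients of the lines through `p`. -/
def pointSum (p : ℙ ℂ (Fin 3 → ℂ)) : (L.Line → K) →ₗ[K] K :=
  (∑ ℓ : L.Line, LinearMap.proj ℓ) ∘ₗ atPoint K p

variable {K}

open Classical in
theorem atPoint_apply (p : ℙ ℂ (Fin 3 → ℂ)) (a : L.Line → K) (ℓ : L.Line) :
    atPoint K p a ℓ = if ℓ.HasPoint p then a ℓ else 0 := by
  unfold atPoint
  rw [LinearMap.pi_apply]
  split_ifs <;> simp

open Classical in
theorem pointSum_apply (p : ℙ ℂ (Fin 3 → ℂ)) (a : L.Line → K) :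
    pointSum K p a = ∑ ℓ : L.Line, if ℓ.HasPoint p then a ℓ else 0 := by
  simp [pointSum, atPoint_apply]

theorem pointSum_atPoint (p : ℙ ℂ (Fin 3 → ℂ)) (a : L.Line → K) :
    pointSum K p (atPoint K p a) = pointSum K p a := by
  classical
  simp only [pointSum_apply, atPoint_apply]
  exact Finset.sum_congr rfl fun ℓ _ => by split_ifs <;> rfl

theorem atPoint_single_of_not {p : ℙ ℂ (Fin 3 → ℂ)} {ℓ : L.Line} (h : ¬ ℓ.HasPoint p) :
    atPoint K p (Pi.single ℓ 1) = 0 := by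
  classical
  ext ℓ'
  rw [atPoint_apply]
  by_cases hl : ℓ' = ℓ
  · subst hl; simp [h]
  · simp [hl]

theorem pointSum_single_of_not {p : ℙ ℂ (Fin 3 → ℂ)} {ℓ : L.Line} (h : ¬ ℓ.HasPoint p) :
    pointSum K p (Pi.single ℓ 1) = 0 := by
  rw [← pointSum_atPoint, atPoint_single_of_not h, map_zero]

theorem pointSum_single {p : ℙ ℂ (Fin 3 → ℂ)} {ℓ : L.Line} (h : ℓ.HasPoint p) :
    pointSum K p (Pi.single ℓ 1) = 1 := by
  classical
  rw [pointSum_apply, Finset.sum_eq_single ℓ] <;> simp +contextual [h]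

variable (K) in
/-- Left multiplication by degree-one elements in the Orlik-Solomon algebra of the lines through
`p`, whose degree-two part is identified with a subspace of the degree-one part by the boundary. -/
def localMul (p : ℙ ℂ (Fin 3 → ℂ)) :
    (L.Line → K) →ₗ[K] Module.End K (K × (L.Line → K) × (L.Line → K)) :=
  LinearMap.mk₂ K
    (fun a x =>
      -- The three factors stand for degrees zero, one and two. A degree-two product is recorded
      -- through its boundary, `∂(ab) = s(a) b - s(b) a`.
      (0, x.1 • atPoint K p a, pointSum K p a • x.2.1 - pointSum K p x.2.1 • atPoint K p a))
    (fun a b x => by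
      ext <;> simp
      all_goals ring)
    (fun r a x => by
      ext <;> simp
      all_goals ring)
    (fun a x y => by
      ext <;> simp
      all_goals ring)
    (fun r a x => by
      ext <;> simp
      all_goals ring)

theorem localMul_apply (p : ℙ ℂ (Fin 3 → ℂ)) (a : L.Line → K)
    (x : K × (L.Line → K) × (L.Line → K)) :
    localMul K p a x =
      (0, x.1 • atPoint K p a, pointSum K p a • x.2.1 - pointSum K p x.2.1 • atPoint K p a) := rfl

theorem localMul_mul_localMul (p : ℙ ℂ (Fin 3 → ℂ)) (a b : L.Line → K)
    (x : K × (L.Line → K) × (L.Line → K)) :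
    (localMul K p a * localMul K p b) x =
      (0, 0, x.1 • (pointSum K p a • atPoint K p b - pointSum K p b • atPoint K p a)) := by
  rw [Module.End.mul_apply, localMul_apply, localMul_apply]
  simp only [zero_smul, map_smul, pointSum_atPoint, smul_eq_mul, Prod.mk.injEq, true_and]
  ext ℓ
  simp
  ring

theorem localMul_mul_mul (p : ℙ ℂ (Fin 3 → ℂ)) (a b c : L.Line → K) :
    localMul K p a * localMul K p b * localMul K p c = 0 := by
  refine LinearMap.ext fun x => ?_
  rw [Module.End.mul_apply, localMul_mul_localMul, localMul_apply]
  simp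

variable (L K) in
/-- The action of the exterior algebra on the Orlik-Solomon algebra of the lines through `p`. -/
def localRep (p : ℙ ℂ (Fin 3 → ℂ)) :
    L.Ext K →ₐ[K] Module.End K (K × (L.Line → K) × (L.Line → K)) :=
  ExteriorAlgebra.lift K ⟨localMul K p, fun a => by
    refine LinearMap.ext fun x => ?_
    rw [localMul_mul_localMul, sub_self, smul_zero]
    rfl⟩

theorem localRep_ι (p : ℙ ℂ (Fin 3 → ℂ)) (a : L.Line → K) :
    localRep L K p (ExteriorAlgebra.ι K a) = localMul K p a :=
  ExteriorAlgebra.lift_ι_apply K _ _ _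

theorem boundary_prod_three (i : Fin 3 → L.Line) :
    L.boundary K (List.ofFn fun j => L.e K (i j)).prod =
      L.e K (i 1) * L.e K (i 2) - L.e K (i 0) * L.e K (i 2) + L.e K (i 0) * L.e K (i 1) := by
  rw [boundary_prod, Fin.sum_univ_three]
  have h1 : (1 : Fin 3).succAbove (0 : Fin 2) = 0 := by decide
  have h3 : (2 : Fin 3).succAbove (0 : Fin 2) = 0 := by decide
  have h4 : (2 : Fin 3).succAbove (1 : Fin 2) = 1 := by decide
  simp [List.ofFn_succ, h1, h3, h4, ← sub_eq_add_neg]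

/-- Circuits have at least three lines. Those with three are concurrent at some `z`: for `p = z` the
three terms telescope, and for `p ≠ z` at most one of the lines passes through `p`, so each term
vanishes. For larger circuits every term of the boundary has at least three factors, and the local
action is zero in degree three. -/
theorem localRep_rel (p : ℙ ℂ (Fin 3 → ℂ)) ⦃x y : L.Ext K⦄ (h : L.OSRel K x y) :
    localRep L K p x = localRep L K p y := by
  obtain ⟨i, hi⟩ := h
  rename_i n
  have hn : 3 ≤ n := by simpa using L.three_le_card_of_dependent hi.prop
  have he : ∀ ℓ, localRep L K p (L.e K ℓ) = localMul K p (Pi.single ℓ 1) := fun ℓ =>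
    localRep_ι _ _
  obtain rfl | ⟨q, rfl⟩ : n = 3 ∨ ∃ q, n = q + 3 + 1 :=
    hn.eq_or_lt.imp Eq.symm fun h => ⟨n - 4, by omega⟩
  · obtain ⟨z, hz⟩ := exists_hasPoint_of_dependent (by simp) hi.prop
    have hz' : ∀ j, (i j).HasPoint z := fun j => hz _ (by simp)
    refine LinearMap.ext fun x => ?_
    rw [boundary_prod_three]
    simp only [map_sub, map_add, map_mul, he, LinearMap.add_apply, LinearMap.sub_apply,
      localMul_mul_localMul, map_zero, LinearMap.zero_apply]
    by_cases hpz : p = z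
    · subst hpz
      simp only [pointSum_single (hz' _), one_smul, Prod.mk_sub_mk, Prod.mk_add_mk, ← smul_sub,
        ← smul_add]
      rw [show atPoint K p (Pi.single (i 2) (1 : K)) - atPoint K p (Pi.single (i 1) 1) -
        (atPoint K p (Pi.single (i 2) 1) - atPoint K p (Pi.single (i 0) 1)) +
        (atPoint K p (Pi.single (i 1) 1) - atPoint K p (Pi.single (i 0) 1)) = 0 by abel, smul_zero]
      simp
    · have hno : ∀ j j', j ≠ j' → ¬ (i j).HasPoint p ∨ ¬ (i j').HasPoint p := by
        intro j j' hj
        by_contra! hcon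
        exact hpz (hasPoint_unique (i.injective.ne hj) hcon.1 hcon.2 (hz' j) (hz' j'))
      have hvan : ∀ j j', j ≠ j' → pointSum K p (Pi.single (i j) 1) •
          atPoint K p (Pi.single (i j') 1) - pointSum K p (Pi.single (i j') 1) •
          atPoint K p (Pi.single (i j) (1 : K)) = 0 := by
        intro j j' hj
        rcases hno j j' hj with h | h <;>
          simp [atPoint_single_of_not h, pointSum_single_of_not h]
      rw [hvan 1 2 (by decide), hvan 0 2 (by decide), hvan 0 1 (by decide)]
      simp
  · rw [boundary_prod, map_sum, map_zero]
    refine Finset.sum_eq_zero fun k _ => ?_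
    rw [map_smul, List.ofFn_succ, List.ofFn_succ, List.ofFn_succ, List.prod_cons, List.prod_cons,
      List.prod_cons, ← mul_assoc, ← mul_assoc, map_mul, map_mul, map_mul, he, he, he,
      localMul_mul_mul, zero_mul, smul_zero]

theorem eq_of_omega_mul_omega_eq_zero {a b : L.Line → K} (h : L.omega K a * L.omega K b = 0)
    {p : ℙ ℂ (Fin 3 → ℂ)} {ℓ : L.Line} (hℓ : ℓ.HasPoint p) :
    pointSum K p a * b ℓ = pointSum K p b * a ℓ := by
  have h1 := congrArg (RingQuot.liftAlgHom K ⟨localRep L K p, localRep_rel p⟩) h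
  simp only [omega, LinearMap.comp_apply, AlgHom.toLinearMap_apply, map_mul, map_zero,
    RingQuot.liftAlgHom_mkAlgHom_apply, localRep_ι] at h1
  -- Acting on the unit of degree zero reads off the boundary of the local part of the product.
  have h2 := LinearMap.congr_fun h1 (1, 0, 0)
  rw [localMul_mul_localMul] at h2
  have h3 := congrFun (congrArg (fun z => z.2.2) h2) ℓ
  simp [atPoint_apply, hℓ] at h3
  exact sub_eq_zero.1 h3

theorem omega_eq_sum (a : L.Line → K) :
    L.omega K a = ∑ ℓ, a ℓ • L.omega K (Pi.single ℓ 1) := by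
  conv_lhs => rw [← Finset.univ_sum_single a, map_sum]
  refine Finset.sum_congr rfl fun ℓ _ => ?_
  rw [← map_smul, ← Pi.single_smul, smul_eq_mul, mul_one]

theorem omega_mul_self (a : L.Line → K) : L.omega K a * L.omega K a = 0 := by
  simp only [omega, LinearMap.comp_apply, AlgHom.toLinearMap_apply]
  rw [← map_mul, ExteriorAlgebra.ι_sq_zero, map_zero]

theorem omega_mul_comm (a b : L.Line → K) :
    L.omega K a * L.omega K b = -(L.omega K b * L.omega K a) := by
  have h := omega_mul_self (a + b)
  rw [map_add, add_mul, mul_add, mul_add, omega_mul_self, omega_mul_self, zero_add, add_zero] at h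
  exact eq_neg_of_add_eq_zero_left h

/-- Three concurrent lines satisfy the Orlik-Solomon relation. -/
theorem omega_mul_of_hasPoint {p : ℙ ℂ (Fin 3 → ℂ)} {o i j : L.Line} (ho : o.HasPoint p)
    (hi : i.HasPoint p) (hj : j.HasPoint p) :
    L.omega K (Pi.single i 1) * L.omega K (Pi.single j 1) =
      L.omega K (Pi.single o 1) * (L.omega K (Pi.single j 1) - L.omega K (Pi.single i 1)) := by
  rw [mul_sub]
  by_cases hij : i = j
  · subst hij; rw [omega_mul_self, sub_self]
  by_cases hoi : o = i
  · subst hoi; rw [omega_mul_self, sub_zero]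
  by_cases hoj : o = j
  · subst hoj; rw [omega_mul_self, zero_sub, omega_mul_comm]
  have hinj : Function.Injective ![o, i, j] := by
    intro x y hxy
    fin_cases x <;> fin_cases y <;> simp_all
  have hcirc : L.IsCircuit (Finset.univ.map ⟨![o, i, j], hinj⟩) := by
    refine isCircuit_of_hasPoint (p := p) (by simp) fun ℓ hℓ => ?_
    obtain ⟨x, -, rfl⟩ := Finset.mem_map.1 hℓ
    fin_cases x <;> simpa
  have h := RingQuot.mkAlgHom_rel K (OSRel.circuit (K := K) _ hcirc)
  rw [Function.Embedding.coeFn_mk, boundary_prod_three, map_add, map_sub, map_mul, map_mul, map_mul,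
    map_zero] at h
  change L.omega K (Pi.single i 1) * L.omega K (Pi.single j 1) -
    L.omega K (Pi.single o 1) * L.omega K (Pi.single j 1) +
    L.omega K (Pi.single o 1) * L.omega K (Pi.single i 1) = 0 at h
  rw [← sub_eq_zero, ← h]
  abel

/-- Group the pairs of distinct lines by their intersection point. At a point `p` with a chosen line
`o`, the three-term relation makes every local product a multiple of `ω_o`, and the coefficient of
`ω_o ω_j` becomes `s_p(a) b_j - s_p(b) a_j`. -/
theorem omega_mul_omega_eq_zero {a b : L.Line → K}
    (h : ∀ p (ℓ : L.Line), ℓ.HasPoint p → pointSum K p a * b ℓ = pointSum K p b * a ℓ) :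
    L.omega K a * L.omega K b = 0 := by
  classical
  let w : L.Line → L.OrlikSolomon K := fun ℓ => L.omega K (Pi.single ℓ 1)
  choose! P hP using fun x : L.Line × L.Line => fun h : x.1 ≠ x.2 => exists_hasPoint h
  have h1 : L.omega K a * L.omega K b =
      ∑ x : L.Line × L.Line with x.1 ≠ x.2, (a x.1 * b x.2) • (w x.1 * w x.2) := by
    rw [Finset.sum_filter_of_ne, Fintype.sum_prod_type, omega_eq_sum a, omega_eq_sum b,
      Finset.sum_mul]
    · refine Finset.sum_congr rfl fun i _ => ?_
      rw [Finset.mul_sum]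
      refine Finset.sum_congr rfl fun j _ => ?_
      rw [smul_mul_smul_comm]
    · rintro ⟨i, j⟩ - hne hij
      obtain rfl : i = j := hij
      exact hne (by rw [omega_mul_self, smul_zero])
  rw [h1, ← Finset.sum_fiberwise_of_maps_to (t := Finset.univ.image P) (g := P)
    (fun x _ => Finset.mem_image_of_mem _ (Finset.mem_univ x))]
  refine Finset.sum_eq_zero fun p _ => ?_
  have h2 : (Finset.univ.filter fun x : L.Line × L.Line => x.1 ≠ x.2).filter (fun x => P x = p) =
      Finset.univ.filter (fun x : L.Line × L.Line =>
        x.1 ≠ x.2 ∧ (x.1.HasPoint p ∧ x.2.HasPoint p)) := by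
    ext x
    simp only [Finset.mem_filter, Finset.mem_univ, true_and]
    refine and_congr_right fun hx => ⟨fun hp => hp ▸ hP x hx, fun hp => ?_⟩
    exact hasPoint_unique hx (hP x hx).1 (hP x hx).2 hp.1 hp.2
  rw [h2]
  by_cases hex : ∃ o : L.Line, o.HasPoint p
  swap
  · refine Finset.sum_eq_zero fun x hx => ?_
    exact (hex ⟨_, (Finset.mem_filter.1 hx).2.2.1⟩).elim
  obtain ⟨o, ho⟩ := hex
  have h3 : ∑ x : L.Line × L.Line with x.1 ≠ x.2 ∧ (x.1.HasPoint p ∧ x.2.HasPoint p),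
      (a x.1 * b x.2) • (w x.1 * w x.2) =
      ∑ i, ∑ j, (atPoint K p a i * atPoint K p b j) • (w o * (w j - w i)) := by
    rw [← Finset.sum_product', Finset.univ_product_univ, Finset.sum_filter]
    refine Finset.sum_congr rfl fun x _ => ?_
    rw [atPoint_apply, atPoint_apply]
    by_cases hx : x.1.HasPoint p ∧ x.2.HasPoint p
    · rw [if_pos hx.1, if_pos hx.2, ← omega_mul_of_hasPoint ho hx.1 hx.2]
      by_cases hne : x.1 = x.2
      · rw [if_neg (by simp [hne]), hne, omega_mul_self, smul_zero]
      · rw [if_pos ⟨hne, hx⟩]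
    · rw [if_neg (fun h => hx h.2)]
      rcases not_and_or.1 hx with hx | hx <;> simp [hx]
  have h4 : ∀ c : L.Line → K, pointSum K p c = ∑ ℓ, atPoint K p c ℓ := fun c => by
    simp [pointSum_apply, atPoint_apply]
  have h5 : ∑ i, ∑ j, (atPoint K p a i * atPoint K p b j) • (w o * (w j - w i)) =
      w o * ∑ j, (pointSum K p a * atPoint K p b j - pointSum K p b * atPoint K p a j) • w j := by
    simp only [mul_sub, smul_sub, Finset.sum_sub_distrib, sub_smul, Finset.mul_sum, mul_smul_comm,
      h4, Finset.sum_mul, Finset.sum_smul]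
    congr 1
    · exact Finset.sum_comm
    · refine Finset.sum_congr rfl fun i _ => Finset.sum_congr rfl fun j _ => ?_
      rw [mul_comm]
  rw [h3, h5]
  convert mul_zero (w o)
  refine Finset.sum_eq_zero fun j _ => ?_
  rw [atPoint_apply, atPoint_apply]
  split_ifs with hj
  · rw [h p j hj, sub_self, zero_smul]
  · simp

end LineArrangement

/-! ### Linear subspaces in the Zariski topology -/

section Zariski

open scoped Topology

variable {ι σ K : Type*} [Field K]

theorem zariski_isClosed_iff {Z : Set (ι → K)} :
    IsClosed[zariskiTopology ι K] Z ↔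
      ∃ S : Set (MvPolynomial ι K), Z = {x | ∀ f ∈ S, MvPolynomial.eval x f = 0} := by
  rw [← @isOpen_compl_iff _ _ (zariskiTopology ι K)]
  change Zᶜᶜ ∈ {Z | ∃ S : Set (MvPolynomial ι K), Z = {x | ∀ f ∈ S, MvPolynomial.eval x f = 0}} ↔ _
  rw [compl_compl]
  rfl

theorem zariski_isClosed_zeroLocus (f : MvPolynomial ι K) :
    IsClosed[zariskiTopology ι K] {x | MvPolynomial.eval x f = 0} :=
  zariski_isClosed_iff.2 ⟨{f}, by simp⟩

theorem exists_eval_comp_linearMap [Finite σ] (φ : (σ → K) →ₗ[K] (ι → K))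
    (f : MvPolynomial ι K) :
    ∃ g : MvPolynomial σ K, ∀ t, MvPolynomial.eval t g = MvPolynomial.eval (φ t) f := by
  classical
  have := Fintype.ofFinite σ
  refine ⟨MvPolynomial.bind₁ (fun i => ∑ s, MvPolynomial.C (φ (Pi.single s 1) i) *
    MvPolynomial.X s) f, fun t => ?_⟩
  rw [← MvPolynomial.coe_aeval_eq_eval, ← MvPolynomial.coe_aeval_eq_eval]
  change MvPolynomial.aeval t _ = MvPolynomial.aeval (φ t) f
  rw [MvPolynomial.aeval_bind₁]
  congr 2
  ext i
  have ht : t = ∑ s, t s • Pi.single s (1 : K) := by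
    conv_lhs => rw [← Finset.univ_sum_single t]
    refine Finset.sum_congr rfl fun s _ => ?_
    rw [← Pi.single_smul, smul_eq_mul, mul_one]
  conv_rhs => rw [ht]
  simp [mul_comm]

theorem zariski_isClosed_submodule [Finite ι] (V : Submodule K (ι → K)) :
    IsClosed[zariskiTopology ι K] (V : Set (ι → K)) := by
  refine zariski_isClosed_iff.2 ⟨{f | ∀ x ∈ V, MvPolynomial.eval x f = 0}, ?_⟩
  refine Set.Subset.antisymm (fun x hx f hf => hf x hx) fun x hx => ?_
  by_contra hxV
  -- A linear functional that separates `x` from `V` is a polynomial of degree one vanishing on `V`.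
  obtain ⟨φ, hφx, hφV⟩ := Submodule.exists_le_ker_of_notMem hxV
  obtain ⟨g, hg⟩ := exists_eval_comp_linearMap (LinearMap.pi fun _ : Unit => φ)
    (MvPolynomial.X ())
  simp only [LinearMap.pi_apply, MvPolynomial.eval_X] at hg
  exact hφx ((hg x).symm.trans (hx g fun y hy => (hg y).trans (hφV hy)))

/-- Two polynomials that do not vanish identically on a linear subspace have a common nonzero. -/
theorem exists_mem_eval_ne_zero [Infinite K] (V : Submodule K (ι → K)) {f g : MvPolynomial ι K}
    {x y : ι → K} (hx : x ∈ V) (hy : y ∈ V) (hf : MvPolynomial.eval x f ≠ 0)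
    (hg : MvPolynomial.eval y g ≠ 0) :
    ∃ z ∈ V, MvPolynomial.eval z f ≠ 0 ∧ MvPolynomial.eval z g ≠ 0 := by
  -- Restrict to the line through `x` and `y`. The restrictions of `f` and `g` are nonzero at `t =
  -- 0` and `t = 1` respectively, and over an infinite field their product has a nonroot.
  have key : ∀ h : MvPolynomial ι K, ∃ P : Polynomial K, ∀ t,
      P.eval t = MvPolynomial.eval (x + t • (y - x)) h := fun h => by
    refine ⟨MvPolynomial.aeval (fun i => Polynomial.C (x i) + Polynomial.X *
      Polynomial.C (y i - x i)) h, fun t => ?_⟩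
    rw [← Polynomial.coe_evalRingHom, MvPolynomial.map_aeval, MvPolynomial.eval,
      MvPolynomial.eval₂Hom_congr _ _ rfl]
    · ext; simp
    · ext i; simp
  obtain ⟨P, hP⟩ := key f
  obtain ⟨Q, hQ⟩ := key g
  have hP0 : P ≠ 0 := by
    rintro rfl
    exact hf (by simpa using (hP 0).symm)
  have hQ0 : Q ≠ 0 := by
    rintro rfl
    exact hg (by simpa using (hQ 1).symm)
  obtain ⟨t, ht⟩ : ∃ t, (P * Q).eval t ≠ 0 := by
    by_contra! hcon
    exact mul_ne_zero hP0 hQ0 (Polynomial.funext fun t => by rw [hcon t, Polynomial.eval_zero])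
  rw [Polynomial.eval_mul, hP, hQ] at ht
  exact ⟨x + t • (y - x), V.add_mem hx (V.smul_mem _ (V.sub_mem hy hx)), left_ne_zero_of_mul ht,
    right_ne_zero_of_mul ht⟩

theorem exists_eval_ne_zero_of_isOpen {U : Set (ι → K)} (hU : IsOpen[zariskiTopology ι K] U)
    {x : ι → K} (hx : x ∈ U) :
    ∃ f : MvPolynomial ι K, MvPolynomial.eval x f ≠ 0 ∧
      ∀ y, MvPolynomial.eval y f ≠ 0 → y ∈ U := by
  obtain ⟨S, hS⟩ := zariski_isClosed_iff.1
    ((@isClosed_compl_iff _ (zariskiTopology ι K) _).2 hU)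
  have hx' : x ∉ Uᶜ := fun h => h hx
  rw [hS] at hx'
  simp only [Set.mem_ofPred_eq, not_forall] at hx'
  obtain ⟨f, hf, hfx⟩ := hx'
  refine ⟨f, hfx, fun y hy => ?_⟩
  by_contra hyU
  have : y ∈ Uᶜ := hyU
  rw [hS] at this
  exact hy (this f hf)

theorem zariski_isIrreducible_submodule [Infinite K] (V : Submodule K (ι → K)) :
    let := zariskiTopology ι K
    IsIrreducible (V : Set (ι → K)) := by
  let := zariskiTopology ι K
  refine ⟨⟨0, V.zero_mem⟩, ?_⟩
  rintro u v hu hv ⟨x, hxV, hx⟩ ⟨y, hyV, hy⟩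
  obtain ⟨f, hf, hfu⟩ := exists_eval_ne_zero_of_isOpen hu hx
  obtain ⟨g, hg, hgv⟩ := exists_eval_ne_zero_of_isOpen hv hy
  obtain ⟨z, hz, hzf, hzg⟩ := exists_mem_eval_ne_zero V hxV hyV hf hg
  exact ⟨z, hz, hfu z hzf, hgv z hzg⟩

/-! ### Krull dimension of a linear subspace -/

theorem zariski_isIrreducible_preimage [Infinite K] {V W : Submodule K (ι → K)} (h : W ≤ V) :
    let := zariskiTopology ι K
    IsIrreducible ((↑) ⁻¹' (W : Set (ι → K)) : Set (V : Set (ι → K))) := by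
  let := zariskiTopology ι K
  refine ⟨⟨⟨0, V.zero_mem⟩, W.zero_mem⟩, ?_⟩
  rintro u v hu hv ⟨x, hxW, hx⟩ ⟨y, hyW, hy⟩
  obtain ⟨u, hu', rfl⟩ := isOpen_induced_iff.1 hu
  obtain ⟨v, hv', rfl⟩ := isOpen_induced_iff.1 hv
  obtain ⟨z, hz, hzu, hzv⟩ := (zariski_isIrreducible_submodule W).2 u v hu' hv' ⟨x, hxW, hx⟩
    ⟨y, hyW, hy⟩
  exact ⟨⟨z, h hz⟩, hz, hzu, hzv⟩

/-- Linear subspaces of `V` are irreducible closed subsets, so the lattice of subspaces, whose chain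
length is the rank, embeds strictly. -/
theorem finrank_le_zariskiDim [Finite ι] [Infinite K] (V : Submodule K (ι → K)) :
    (Module.finrank K V : WithBot ℕ∞) ≤ zariskiDim (V : Set (ι → K)) := by
  let := zariskiTopology ι K
  have h1 : Order.krullDim (Submodule K V) = Module.finrank K V := by
    rw [← Module.coe_length K V, Module.length_eq_finrank]
    rfl
  rw [← h1, zariskiDim, topologicalKrullDim]
  have hle : ∀ W : Submodule K V, W.map V.subtype ≤ V := fun W => V.map_subtype_le W
  refine Order.krullDim_le_of_strictMono
    (fun W => ⟨_, zariski_isIrreducible_preimage (hle W),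
      (zariski_isClosed_submodule _).preimage continuous_subtype_val⟩) ?_
  refine Monotone.strictMono_of_injective ?_ ?_
  · intro W W' h x hx
    exact Submodule.map_mono h hx
  · intro W W' h
    ext x
    have := congrArg (fun Z : TopologicalSpace.IrreducibleCloseds (V : Set (ι → K)) =>
      x ∈ (Z : Set (V : Set (ι → K)))) h
    simpa using this

/-- Vanishing ideals of irreducible closed subsets are primes of the polynomial ring in linear
coordinates on `V`, and they reverse inclusion strictly; the Krull dimension of that ring bounds the
chains. -/
theorem zariskiDim_le_finrank [Finite ι] (V : Submodule K (ι → K)) :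
    zariskiDim (V : Set (ι → K)) ≤ Module.finrank K V := by
  let := zariskiTopology ι K
  let e : (Fin (Module.finrank K V) → K) ≃ₗ[K] V := (Module.finBasis K V).equivFun.symm
  -- Coordinates on `V` are extended to the ambient space so that polynomials in them pull back to
  -- polynomials there.
  obtain ⟨ψ, hψ⟩ := LinearMap.exists_extend e.symm.toLinearMap
  have hψ' : ∀ x : V, ψ x = e.symm x := fun x => LinearMap.congr_fun hψ x
  have h1 : ringKrullDim (MvPolynomial (Fin (Module.finrank K V)) K) = Module.finrank K V := by
    rw [MvPolynomial.ringKrullDim_of_isNoetherianRing, ringKrullDim_eq_zero_of_field]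
    simp
  rw [← h1, zariskiDim, topologicalKrullDim, ringKrullDim,
    ← Order.krullDim_orderDual (α := PrimeSpectrum _)]
  let I : TopologicalSpace.IrreducibleCloseds (V : Set (ι → K)) →
      Ideal (MvPolynomial (Fin (Module.finrank K V)) K) := fun Z =>
    { carrier := {f | ∀ x ∈ (Z : Set (V : Set (ι → K))), MvPolynomial.eval (ψ x) f = 0}
      add_mem' := fun hf hg x hx => by rw [map_add, hf x hx, hg x hx, add_zero]
      zero_mem' := fun x _ => map_zero _
      smul_mem' := fun c f hf x hx => by rw [smul_eq_mul, map_mul, hf x hx, mul_zero] }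
  have hmem : ∀ Z f, f ∈ I Z ↔ ∀ x ∈ (Z : Set (V : Set (ι → K))), MvPolynomial.eval (ψ x) f = 0 :=
    fun Z f => Iff.rfl
  have hopen : ∀ f : MvPolynomial (Fin (Module.finrank K V)) K,
      IsOpen {x : (V : Set (ι → K)) | MvPolynomial.eval (ψ x) f ≠ 0} := fun f => by
    obtain ⟨g, hg⟩ := exists_eval_comp_linearMap ψ f
    simp only [← hg]
    exact ((zariski_isClosed_zeroLocus g).preimage continuous_subtype_val).isOpen_compl
  have hprime : ∀ Z, (I Z).IsPrime := fun Z => by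
    refine Ideal.isPrime_iff.2 ⟨fun htop => ?_, fun {f g} hfg => ?_⟩
    · obtain ⟨x, hx⟩ := Z.isIrreducible.1
      have := (hmem Z 1).1 (htop ▸ Submodule.mem_top) x hx
      simp at this
    · by_contra! hcon
      simp only [hmem, not_forall] at hcon
      obtain ⟨⟨x, hx, hxf⟩, ⟨y, hy, hyg⟩⟩ := hcon
      obtain ⟨z, hz, hzf, hzg⟩ := Z.isIrreducible.2 _ _ (hopen f) (hopen g) ⟨x, hx, hxf⟩
        ⟨y, hy, hyg⟩
      have := (hmem Z _).1 hfg z hz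
      rw [map_mul] at this
      exact mul_ne_zero hzf hzg this
  refine Order.krullDim_le_of_strictMono (fun Z => OrderDual.toDual ⟨I Z, hprime Z⟩) ?_
  intro Z Z' hlt
  refine lt_of_le_not_ge (fun f hf x hx => hf x (hlt.le hx)) fun hle => hlt.not_ge fun x hx => ?_
  obtain ⟨T, hT, hTZ⟩ := isClosed_induced_iff.1 Z.isClosed
  obtain ⟨S, rfl⟩ := zariski_isClosed_iff.1 hT
  change x ∈ (Z : Set (V : Set (ι → K)))
  rw [← hTZ]
  intro f hf
  -- Each ambient equation of `Z`, rewritten in the coordinates of `V`, belongs to `I Z`; so `I Z`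
  -- determines `Z`.
  obtain ⟨g, hg⟩ := exists_eval_comp_linearMap (V.subtype ∘ₗ e.toLinearMap) f
  have hgx : ∀ x : (V : Set (ι → K)), MvPolynomial.eval (ψ x) g = MvPolynomial.eval x.1 f := by
    intro x
    rw [hg, hψ' x]
    simp
  have hgZ : g ∈ I Z := fun y hy => by
    rw [hgx]
    rw [← hTZ] at hy
    exact hy f hf
  rw [← hgx]
  exact hle hgZ x hx

theorem zariskiDim_submodule [Finite ι] [Infinite K] (V : Submodule K (ι → K)) :
    zariskiDim (V : Set (ι → K)) = Module.finrank K V :=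
  (zariskiDim_le_finrank V).antisymm (finrank_le_zariskiDim V)

end Zariski

/-! ### Block-diagonal matrices of Cartan type -/

section CartanType

variable {P ι κ : Type*}

/-- A symmetric matrix with nonpositive off-diagonal entries that is the direct sum of its
indecomposable diagonal blocks on the fibres of `c`. -/
structure ConnectedBlocks {F : Type*} [CommRing F] [LinearOrder F] (A : Matrix ι ι F)
    (c : ι → κ) : Prop where
  symm : ∀ i j, A i j = A j i
  nonpos : ∀ i j, i ≠ j → A i j ≤ 0
  block : ∀ i j, c i ≠ c j → A i j = 0
  conn : ∀ i j, c i = c j → Relation.ReflTransGen (fun i j => i ≠ j → A i j ≠ 0) i j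

open Classical in
/-- The vector that agrees with `x` on the fibre of `c` over `k` and vanishes elsewhere. -/
def onClass {F : Type*} [Zero F] (c : ι → κ) (k : κ) (x : ι → F) : ι → F :=
  fun i => if c i = k then x i else 0

theorem onClass_of_eq {F : Type*} [Zero F] {c : ι → κ} {k : κ} {i : ι} (h : c i = k) (x : ι → F) :
    onClass c k x i = x i := if_pos h

theorem onClass_of_ne {F : Type*} [Zero F] {c : ι → κ} {k : κ} {i : ι} (h : c i ≠ k) (x : ι → F) :
    onClass c k x i = 0 := if_neg h

theorem ConnectedBlocks.map_intCast {F : Type*} [Field F] [LinearOrder F]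
    [IsStrictOrderedRing F] {c : ι → κ} {Q : Matrix ι ι ℤ} (h : ConnectedBlocks Q c) :
    ConnectedBlocks (Q.map (Int.cast : ℤ → F)) c where
  symm i j := by simp [h.symm i j]
  nonpos i j hij := by simpa using h.nonpos i j hij
  block i j hij := by simp [h.block i j hij]
  conn i j hij := (h.conn i j hij).lift id fun a b hab hne => by simpa using hab hne

variable [Fintype ι]

/-- A `ℚ`-linear functional commutes with integer coefficients. This carries kernel vectors from
`K`, which has no order, to `ℚ`, where positivity makes sense. -/
theorem intMatrix_mulVec_dual {K : Type*} [Field K] [CharZero K] (B : Matrix P ι ℤ)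
    (f : Module.Dual ℚ K) (x : ι → K) :
    (B.map (Int.cast : ℤ → ℚ)).mulVec (fun i => f (x i)) =
      fun p => f ((B.map (Int.cast : ℤ → K)).mulVec x p) := by
  ext p
  simp only [Matrix.mulVec, dotProduct, Matrix.map_apply, map_sum]
  refine Finset.sum_congr rfl fun i _ => ?_
  rw [← zsmul_eq_mul, ← zsmul_eq_mul, map_zsmul]

theorem gram_mulVec [Fintype P] {F : Type*} [CommRing F] {A : Matrix ι ι F} {J : Matrix P ι F}
    (hA : A = J.transpose * J - Matrix.of fun _ _ => 1) (x : ι → F) :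
    A.mulVec x = J.transpose.mulVec (J.mulVec x) - fun _ => ∑ i, x i := by
  rw [hA, Matrix.sub_mulVec, Matrix.mulVec_mulVec]
  congr 1
  ext i
  simp [Matrix.mulVec, dotProduct]

theorem ConnectedBlocks.sum_mul_mulVec {F : Type*} [CommRing F] [LinearOrder F]
    {A : Matrix ι ι F} {c : ι → κ} (h : ConnectedBlocks A c) (x y : ι → F) :
    ∑ i, x i * A.mulVec y i = ∑ i, A.mulVec x i * y i := by
  have hs : A.transpose = A := by
    ext i j
    exact h.symm j i
  change x ⬝ᵥ A.mulVec y = A.mulVec x ⬝ᵥ y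
  rw [Matrix.dotProduct_mulVec]
  conv_rhs => rw [← hs, Matrix.mulVec_transpose]

theorem ConnectedBlocks.mulVec_onClass {F : Type*} [CommRing F] [LinearOrder F]
    {A : Matrix ι ι F} {c : ι → κ} (h : ConnectedBlocks A c) (k : κ) (x : ι → F) :
    A.mulVec (onClass c k x) = onClass c k (A.mulVec x) := by
  classical
  ext i
  by_cases hi : c i = k
  · rw [onClass_of_eq hi]
    refine Finset.sum_congr rfl fun j _ => ?_
    change A i j * _ = A i j * _
    by_cases hj : c j = k
    · rw [onClass_of_eq hj]
    · rw [onClass_of_ne hj, h.block i j (by rw [hi]; exact Ne.symm hj), zero_mul, zero_mul]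
  · rw [onClass_of_ne hi]
    refine Finset.sum_eq_zero fun j _ => ?_
    change A i j * _ = 0
    by_cases hj : c j = k
    · rw [h.block i j (by rw [hj]; exact hi), zero_mul]
    · rw [onClass_of_ne hj, mul_zero]

theorem ConnectedBlocks.dotProduct_onClass {F : Type*} [CommRing F] [LinearOrder F]
    {A : Matrix ι ι F} {c : ι → κ} (h : ConnectedBlocks A c) {k l : κ} (hkl : k ≠ l) (x y : ι → F) :
    onClass c k x ⬝ᵥ A.mulVec (onClass c l y) = 0 := by
  rw [h.mulVec_onClass]
  refine Finset.sum_eq_zero fun i _ => ?_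
  by_cases hi : c i = k
  · rw [onClass_of_ne (k := l) (by rw [hi]; exact hkl), mul_zero]
  · rw [onClass_of_ne hi, zero_mul]

/-! ### Positivity arguments over an ordered field -/

namespace ConnectedBlocks

variable {F : Type*} [Field F] [LinearOrder F] [IsStrictOrderedRing F] {A : Matrix ι ι F}
  {c : ι → κ}

/-- A nonnegative kernel vector of a block that has a zero coordinate vanishes. -/
theorem eq_zero_of_mulVec_eq_zero (h : ConnectedBlocks A c) {k : κ} {y : ι → F}
    (hy : ∀ i, c i = k → 0 ≤ y i) (hAy : ∀ i, c i = k → A.mulVec y i = 0) {i : ι} (hi : c i = k)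
    (hyi : y i = 0) {j : ι} (hj : c j = k) : y j = 0 := by
  -- Where `y i = 0`, the equation `(A y) i = 0` is a vanishing sum of nonpositive terms, so `y`
  -- also vanishes at every neighbour of `i`; zeros spread over the class.
  have step : ∀ i j, (c i = k ∧ y i = 0) → (i ≠ j → A i j ≠ 0) → (c j = k ∧ y j = 0) := by
    rintro i j ⟨hi, hyi⟩ hij
    by_cases hne : i = j
    · exact hne ▸ ⟨hi, hyi⟩
    have hcij : c i = c j := by
      by_contra hc
      exact hij hne (h.block i j hc)
    have hle : ∀ l ∈ Finset.univ, A i l * y l ≤ 0 := by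
      intro l _
      by_cases hil : i = l
      · rw [← hil, hyi, mul_zero]
      by_cases hl : c l = k
      · exact mul_nonpos_of_nonpos_of_nonneg (h.nonpos i l hil) (hy l hl)
      · rw [h.block i l (by rw [hi]; exact Ne.symm hl), zero_mul]
    have h0 := (Finset.sum_eq_zero_iff_of_nonpos hle).1 (hAy i hi) j (Finset.mem_univ j)
    exact ⟨hcij ▸ hi, (mul_eq_zero.1 h0).resolve_left (hij hne)⟩
  have key := h.conn i j (hi.trans hj.symm)
  have : c j = k ∧ y j = 0 := by
    clear hj
    induction key with
    | refl => exact ⟨hi, hyi⟩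
    | tail _ hbc ih => exact step _ _ ih hbc
  exact this.2

/-- A kernel vector is proportional on each class to a positive kernel vector. -/
theorem mul_eq_mul_of_mulVec_eq_zero (h : ConnectedBlocks A c) {m x : ι → F} (hm : ∀ i, 0 < m i)
    (hAm : A.mulVec m = 0) (hAx : A.mulVec x = 0) {i j : ι} (hij : c i = c j) :
    x i * m j = x j * m i := by
  classical
  -- Subtracting the smallest ratio `x / m` times `m` leaves a kernel vector that is nonnegative on
  -- the class and zero at `o`, hence zero on the class.
  obtain ⟨o, ho, hmin⟩ := Finset.exists_min_image (Finset.univ.filter fun l => c l = c i)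
    (fun l => x l / m l) ⟨i, by simp⟩
  simp only [Finset.mem_filter, Finset.mem_univ, true_and] at ho hmin
  have h0 : ∀ l, c l = c i → x l - x o / m o * m l = 0 := fun l hl => by
    refine h.eq_zero_of_mulVec_eq_zero (k := c i) (y := x - (x o / m o) • m) (fun j hj => ?_)
      (fun j hj => ?_) ho ?_ hl
    · have := hmin j hj
      rw [le_div_iff₀ (hm j)] at this
      simpa using this
    · rw [Matrix.mulVec_sub, Matrix.mulVec_smul, hAm, hAx]
      simp
    · simp [div_mul_cancel₀ _ (hm o).ne']
  rw [sub_eq_zero.1 (h0 i rfl), sub_eq_zero.1 (h0 j hij.symm)]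
  ring

/-- Diagonal terms are unchanged, and off the diagonal a nonpositive entry multiplies a product that
can only grow. -/
theorem dotProduct_abs_le (h : ConnectedBlocks A c) (x : ι → F) :
    (fun i => |x i|) ⬝ᵥ A.mulVec (fun i => |x i|) ≤ x ⬝ᵥ A.mulVec x := by
  simp only [dotProduct, Matrix.mulVec, Finset.mul_sum]
  refine Finset.sum_le_sum fun i _ => Finset.sum_le_sum fun j _ => ?_
  by_cases hij : i = j
  · subst hij
    rw [mul_left_comm, abs_mul_abs_self, mul_left_comm (x i)]
  · rw [mul_left_comm, mul_left_comm (x i), ← abs_mul]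
    exact mul_le_mul_of_nonpos_left (le_abs_self _) (h.nonpos i j hij)

variable [Fintype P] {J : Matrix P ι F}

/-- Normalized nonnegative vectors supported on different classes whose quadratic forms are
nonpositive have the same image under `J`. -/
theorem mulVec_eq_of_dotProduct_nonpos (h : ConnectedBlocks A c)
    (hA : A = J.transpose * J - Matrix.of fun _ _ => 1) {k l : κ} (hkl : k ≠ l) {x y : ι → F}
    (hx : onClass c k x = x) (hy : onClass c l y = y) (hqx : x ⬝ᵥ A.mulVec x ≤ 0)
    (hqy : y ⬝ᵥ A.mulVec y ≤ 0) (hxy : ∑ i, x i = ∑ i, y i) :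
    J.mulVec x = J.mulVec y ∧ A.mulVec x = 0 := by
  have hs : ∑ i, (x - y) i = 0 := by simp [hxy]
  have h1 : (x - y) ⬝ᵥ A.mulVec (x - y) ≤ 0 := by
    have hxy0 := h.dotProduct_onClass hkl x y
    have hyx0 := h.dotProduct_onClass hkl.symm y x
    rw [hx, hy] at hxy0 hyx0
    rw [Matrix.mulVec_sub, dotProduct_sub, sub_dotProduct, sub_dotProduct, hxy0, hyx0]
    linarith
  -- On vectors of sum zero the all-ones matrix drops out and the form is a sum of squares.
  have h2 : (x - y) ⬝ᵥ A.mulVec (x - y) = J.mulVec (x - y) ⬝ᵥ J.mulVec (x - y) := by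
    rw [gram_mulVec hA, hs, dotProduct_sub, Matrix.dotProduct_mulVec, Matrix.vecMul_transpose]
    simp [dotProduct]
  have h3 : J.mulVec (x - y) = 0 := by
    rw [h2] at h1
    have h0 : J.mulVec (x - y) ⬝ᵥ J.mulVec (x - y) = 0 :=
      h1.antisymm (Finset.sum_nonneg fun i _ => mul_self_nonneg _)
    exact dotProduct_self_eq_zero.1 h0
  have h4 : A.mulVec (x - y) = 0 := by
    rw [gram_mulVec hA, h3, hs, Matrix.mulVec_zero]
    exact sub_self _
  refine ⟨sub_eq_zero.1 (by rw [← Matrix.mulVec_sub, h3]), ?_⟩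
  -- The part of `x - y` on class `k` is `x`, so `A (x - y) = 0` restricts to `A x = 0`.
  have h5 := h.mulVec_onClass k (x - y)
  have h6 : onClass c k (x - y) = x := by
    ext i
    by_cases hi : c i = k
    · rw [onClass_of_eq hi, Pi.sub_apply, ← hy, onClass_of_ne (k := l) (by rw [hi]; exact hkl),
        sub_zero]
    · rw [← hx, onClass_of_ne hi, onClass_of_ne hi]
  rw [h6, h4] at h5
  rw [h5]
  ext i
  by_cases hi : c i = k
  · rw [onClass_of_eq hi]
  · rw [onClass_of_ne hi, Pi.zero_apply]

open Classical in
/-- If `A = Jᵀ J - E` has at least two blocks and every block is singular, then it has a positive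
kernel vector whose restrictions to the classes have the same sum and the same image under `J`. -/
theorem exists_pos_mulVec_eq_zero [Nontrivial κ] (h : ConnectedBlocks A c)
    (hA : A = J.transpose * J - Matrix.of fun _ _ => 1)
    (hu : ∀ k, ∃ u : ι → F, A.mulVec u = 0 ∧ ∃ i, c i = k ∧ u i ≠ 0) :
    ∃ v : ι → F, (∀ i, 0 < v i) ∧ A.mulVec v = 0 ∧ (∀ k, ∑ i with c i = k, v i = 1) ∧
      ∀ k l p, ∑ i with c i = k, J p i * v i = ∑ i with c i = l, J p i * v i := by
  have hw : ∀ k, ∃ w : ι → F, onClass c k w = w ∧ (∀ i, 0 ≤ w i) ∧ (∑ i, w i = 1) ∧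
      w ⬝ᵥ A.mulVec w ≤ 0 := by
    intro k
    obtain ⟨u, hAu, i, hi, hui⟩ := hu k
    -- The kernel vector has form zero on the class, so its absolute value has nonpositive form;
    -- dividing by the sum, which is positive, normalizes it.
    let w : ι → F := fun i => |onClass c k u i|
    have hw0 : ∀ i, 0 ≤ w i := fun i => abs_nonneg _
    have hs : 0 < ∑ i, w i := by
      refine Finset.sum_pos' (fun i _ => hw0 i) ⟨i, Finset.mem_univ i, ?_⟩
      simpa [w, onClass_of_eq hi] using hui
    refine ⟨(∑ i, w i)⁻¹ • w, ?_, fun i => ?_, ?_, ?_⟩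
    · ext j
      by_cases hj : c j = k
      · rw [onClass_of_eq hj]
      · rw [onClass_of_ne hj]
        simp [w, onClass_of_ne hj]
    · exact mul_nonneg (inv_nonneg.2 hs.le) (hw0 i)
    · simp only [Pi.smul_apply, smul_eq_mul, ← Finset.mul_sum]
      exact inv_mul_cancel₀ hs.ne'
    · rw [Matrix.mulVec_smul, dotProduct_smul, smul_dotProduct, smul_smul, smul_eq_mul]
      refine mul_nonpos_of_nonneg_of_nonpos (mul_self_nonneg _) ?_
      refine (h.dotProduct_abs_le (onClass c k u)).trans ?_
      rw [h.mulVec_onClass, hAu]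
      refine (Finset.sum_eq_zero fun j _ => ?_).le
      by_cases hj : c j = k
      · rw [onClass_of_eq (x := (0 : ι → F)) hj, Pi.zero_apply, mul_zero]
      · rw [onClass_of_ne (x := (0 : ι → F)) hj, mul_zero]
  choose w hwc hw0 hw1 hwq using hw
  have hJ : ∀ k l, J.mulVec (w k) = J.mulVec (w l) := by
    intro k l
    by_cases hkl : k = l
    · rw [hkl]
    · exact (h.mulVec_eq_of_dotProduct_nonpos hA hkl (hwc k) (hwc l) (hwq k) (hwq l)
        ((hw1 k).trans (hw1 l).symm)).1
  have hAw : ∀ k, A.mulVec (w k) = 0 := by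
    intro k
    -- A second class is needed to compare with, hence the hypothesis `Nontrivial κ`.
    obtain ⟨l, hl⟩ := exists_ne k
    exact (h.mulVec_eq_of_dotProduct_nonpos hA hl.symm (hwc k) (hwc l) (hwq k) (hwq l)
        ((hw1 k).trans (hw1 l).symm)).2
  have hv : ∀ k, onClass c k (fun i => w (c i) i) = w k := by
    intro k
    ext i
    by_cases hi : c i = k
    · rw [onClass_of_eq hi, hi]
    · rw [onClass_of_ne hi, ← hwc k, onClass_of_ne hi]
  have hsum : ∀ (k : κ) (g : ι → F), ∑ i with c i = k, g i * w (c i) i = ∑ i, g i * w k i := by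
    intro k g
    rw [Finset.sum_filter]
    refine Finset.sum_congr rfl fun i _ => ?_
    rw [← hv k]
    by_cases hi : c i = k
    · rw [onClass_of_eq hi, if_pos hi]
    · rw [onClass_of_ne hi, if_neg hi, mul_zero]
  refine ⟨fun i => w (c i) i, fun i => ?_, ?_, fun k => ?_, fun k l p => ?_⟩
  · refine lt_of_le_of_ne (hw0 _ _) fun h0 => ?_
    have hz : w (c i) = 0 := by
      ext j
      by_cases hj : c j = c i
      · exact h.eq_zero_of_mulVec_eq_zero (fun i _ => hw0 _ i)
          (fun i _ => congrFun (hAw (c _)) i) rfl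
          h0.symm hj
      · rw [← hwc, onClass_of_ne hj, Pi.zero_apply]
    have := hw1 (c i)
    rw [hz] at this
    simp at this
  · ext i
    have := congrFun (h.mulVec_onClass (c i) fun i => w (c i) i) i
    rw [onClass_of_eq rfl, hv, hAw] at this
    exact this.symm
  · simpa [hw1 k] using hsum k fun _ => 1
  · rw [hsum, hsum]
    exact congrFun (hJ k l) p

end ConnectedBlocks

/-- The block on a class, in the presence of a positive kernel vector, is of affine type. -/
theorem ConnectedBlocks.isAffineCartan {A : Matrix ι ι ℝ} {c : ι → κ} (h : ConnectedBlocks A c)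
    {m : ι → ℝ} (hm : ∀ i, 0 < m i) (hAm : A.mulVec m = 0) (k : κ) [Fintype {i // c i = k}]
    (hk : ∃ i, c i = k) :
    let B : Matrix {i // c i = k} {i // c i = k} ℝ := A.submatrix Subtype.val Subtype.val
    IsAffineCartan B ∧
      LinearMap.ker B.mulVecLin = Submodule.span ℝ {fun i => m i.1} := by
  classical
  intro B
  obtain ⟨o, ho⟩ := hk
  have hB : ∀ (x : ι → ℝ) (i : {i // c i = k}),
      B.mulVec (fun j => x j.1) i = A.mulVec x i.1 := by
    intro x i
    have h1 := congrFun (h.mulVec_onClass k x) i.1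
    rw [onClass_of_eq i.2] at h1
    rw [← h1]
    change ∑ j : {i // c i = k}, A i.1 j.1 * x j.1 = ∑ j, A i.1 j * onClass c k x j
    simp only [onClass, mul_ite, mul_zero]
    rw [← Finset.sum_filter]
    exact (Finset.sum_subtype (Finset.univ.filter fun j => c j = k) (fun j => by simp)
      fun j => A i.1 j * x j).symm
  have hext : ∀ x : {i // c i = k} → ℝ, ∃ y : ι → ℝ, onClass c k y = y ∧ x = fun j => y j.1 := by
    intro x
    refine ⟨fun i => if hi : c i = k then x ⟨i, hi⟩ else 0, ?_, ?_⟩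
    · ext i
      by_cases hi : c i = k
      · rw [onClass_of_eq hi]
      · rw [onClass_of_ne hi, dif_neg hi]
    · ext i
      simp [i.2]
  have hBm : B.mulVec (fun j => m j.1) = 0 := by
    ext i
    rw [hB, hAm]
    rfl
  have hker : LinearMap.ker B.mulVecLin = Submodule.span ℝ {fun i => m i.1} := by
    refine le_antisymm (fun x hx => ?_) ?_
    · obtain ⟨y, hy, rfl⟩ := hext x
      have hx : B.mulVec (fun j => y j.1) = 0 := hx
      have hAy : A.mulVec y = 0 := by
        rw [← hy, h.mulVec_onClass]
        ext i
        by_cases hi : c i = k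
        · rw [onClass_of_eq hi, ← hB y ⟨i, hi⟩, hx]
          rfl
        · rw [onClass_of_ne hi]
          rfl
      refine Submodule.mem_span_singleton.2 ⟨y o / m o, ?_⟩
      ext i
      have := h.mul_eq_mul_of_mulVec_eq_zero hm hAm hAy (i.2.trans ho.symm)
      have := (hm o).ne'
      simp only [Pi.smul_apply, smul_eq_mul]
      field_simp
      linarith
    · rw [Submodule.span_singleton_le_iff_mem]
      exact hBm
  refine ⟨⟨fun i j hij => h.nonpos _ _ (Subtype.coe_injective.ne hij), fun i j hij => ?_, ?_, ?_,
    ⟨_, fun i => hm i.1, hBm⟩, ?_⟩, hker⟩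
  · change A j.1 i.1 = 0
    rw [h.symm]
    exact hij
  · rintro S ⟨i, hi⟩ ⟨j, hj⟩
    by_contra! hcon
    have step : ∀ i j, (∃ hi : c i = k, (⟨i, hi⟩ : {i // c i = k}) ∈ S) → (i ≠ j → A i j ≠ 0) →
        (∃ hj : c j = k, (⟨j, hj⟩ : {i // c i = k}) ∈ S) := by
      rintro i j ⟨hi, hiS⟩ hij
      by_cases hne : i = j
      · exact hne ▸ ⟨hi, hiS⟩
      have hcij : c i = c j := by
        by_contra hc
        exact hij hne (h.block i j hc)
      refine ⟨hcij ▸ hi, ?_⟩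
      by_contra hjS
      exact hij hne (hcon _ hiS _ hjS)
    have key := h.conn i.1 j.1 (i.2.trans j.2.symm)
    have : ∃ hj : c j.1 = k, (⟨j.1, hj⟩ : {i // c i = k}) ∈ S := by
      generalize j.1 = j' at key
      induction key with
      | refl => exact ⟨i.2, hi⟩
      | tail _ hbc ih => exact step _ _ ih hbc
    exact hj this.2
  · rw [hker, finrank_span_singleton]
    exact fun h0 => (hm o).ne' (congrFun h0 ⟨o, ho⟩)
  · intro v hv
    obtain ⟨y, hy, rfl⟩ := hext v
    have hAy : ∀ i, c i ≠ k → A.mulVec y i = 0 := by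
      intro i hi
      rw [← hy, h.mulVec_onClass, onClass_of_ne hi]
    have hnn : ∀ i, 0 ≤ A.mulVec y i := by
      intro i
      by_cases hi : c i = k
      · rw [← hB y ⟨i, hi⟩]
        exact hv _
      · rw [hAy i hi]
    -- By symmetry `A y` is orthogonal to the positive kernel vector `m`; being nonnegative, it must
    -- vanish.
    have h0 : ∑ i, m i * A.mulVec y i = 0 := by
      rw [h.sum_mul_mulVec, hAm]
      simp
    ext i
    rw [hB]
    have := (Finset.sum_eq_zero_iff_of_nonneg
      (fun i _ => mul_nonneg (hm i).le (hnn i))).1 h0 i.1 (Finset.mem_univ _)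
    exact (mul_eq_zero.1 this).resolve_left (hm i.1).ne'

/-- Positive rational vectors are multiples of primitive integer vectors. -/
theorem exists_eq_mul_pnat [Nonempty ι] (v : ι → ℚ) (hv : ∀ i, 0 < v i) :
    ∃ (t : ℚ) (m : ι → ℕ+), 0 < t ∧ (∀ i, v i = t * (m i : ℕ)) ∧
      Finset.univ.gcd (fun i => (m i : ℕ)) = 1 := by
  classical
  let N : ℕ := ∏ i, (v i).den
  have hN : 0 < N := Finset.prod_pos fun i _ => (v i).den_pos
  -- This is `N * v i` written as a natural number; dividing by the common gcd `g` gives `m`, whence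
  -- the scale `g / N`.
  let n : ι → ℕ := fun i => (v i).num.toNat * ∏ j ∈ Finset.univ.erase i, (v j).den
  have hn : ∀ i, (n i : ℚ) = N * v i := by
    intro i
    have h1 : N = (v i).den * ∏ j ∈ Finset.univ.erase i, (v j).den :=
      (Finset.mul_prod_erase _ _ (Finset.mem_univ i)).symm
    have h2 : ((v i).num.toNat : ℚ) = (v i).num := by
      exact_mod_cast Int.toNat_of_nonneg (Rat.num_pos.2 (hv i)).le
    rw [h1]
    simp only [n, Nat.cast_mul, h2]
    conv_rhs => rw [mul_right_comm]
    congr 1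
    rw [mul_comm, Rat.mul_den_eq_num]
  have hnpos : ∀ i, 0 < n i := fun i => by
    have : (0 : ℚ) < n i := by
      rw [hn]
      exact mul_pos (by exact_mod_cast hN) (hv i)
    exact_mod_cast this
  obtain ⟨m, hm, hgcd⟩ := Finset.extract_gcd n (Finset.univ_nonempty (α := ι))
  set g := Finset.univ.gcd n
  have hmpos : ∀ i, 0 < m i := fun i => Nat.pos_of_ne_zero fun h0 => by
    have := hm i (Finset.mem_univ i)
    rw [h0, mul_zero] at this
    exact (hnpos i).ne' this
  have hg : 0 < g := Nat.pos_of_ne_zero fun h0 => by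
    obtain ⟨i⟩ := ‹Nonempty ι›
    have := hm i (Finset.mem_univ i)
    rw [h0, zero_mul] at this
    exact (hnpos i).ne' this
  refine ⟨g / N, fun i => ⟨m i, hmpos i⟩, by positivity, fun i => ?_, hgcd⟩
  have h1 := hn i
  rw [hm i (Finset.mem_univ i), Nat.cast_mul] at h1
  have : (N : ℚ) ≠ 0 := by positivity
  rw [PNat.mk_coe, div_mul_eq_mul_div, h1, mul_div_cancel_left₀ _ this]

/-! ### Kernel vectors over a field of characteristic zero -/

section Descent

variable {K : Type*} [Field K] [CharZero K]

/-- The identity is tested on every `ℚ`-linear functional of `K`: each turns `x` into a rational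
kernel vector, to which the ordered-field argument applies, and functionals separate points. -/
theorem ConnectedBlocks.mul_eq_mul_of_charZero {Q : Matrix ι ι ℤ} {c : ι → κ}
    (h : ConnectedBlocks Q c) {m : ι → ℕ+}
    (hQm : (Q.map (Int.cast : ℤ → ℚ)).mulVec (fun i => ((m i : ℕ) : ℚ)) = 0) {x : ι → K}
    (hQx : (Q.map (Int.cast : ℤ → K)).mulVec x = 0) {i j : ι} (hij : c i = c j) :
    x i * (m j : ℕ) = x j * (m i : ℕ) := by
  rw [← sub_eq_zero, ← Module.forall_dual_apply_eq_zero_iff ℚ]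
  intro f
  have h1 : (Q.map (Int.cast : ℤ → ℚ)).mulVec (fun i => f (x i)) = 0 := by
    rw [intMatrix_mulVec_dual, hQx]
    ext
    simp
  have h2 := h.map_intCast.mul_eq_mul_of_mulVec_eq_zero
    (fun i => by exact_mod_cast (m i).pos) hQm h1 hij
  rw [map_sub, mul_comm, ← nsmul_eq_mul, map_nsmul, mul_comm (x j), ← nsmul_eq_mul, map_nsmul,
    nsmul_eq_mul, nsmul_eq_mul, mul_comm, h2, mul_comm, sub_self]

end Descent

end CartanType

/-! ### The classes of a set of points -/

namespace LineArrangement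

variable {L : LineArrangement} {X : Finset (ℙ ℂ (Fin 3 → ℂ))}

theorem MeetIn.symm {ℓ ℓ' : L.Line} (h : MeetIn X ℓ ℓ') : MeetIn X ℓ' ℓ := by
  obtain ⟨p, hp, h1, h2⟩ := h
  exact ⟨p, hp, h2, h1⟩

variable (L) in
/-- Two lines are equivalent if they are joined by a sequence of lines whose successive members
meet outside `X`. -/
def classSetoid (X : Finset (ℙ ℂ (Fin 3 → ℂ))) : Setoid L.Line where
  r := Relation.ReflTransGen fun ℓ₁ ℓ₂ : L.Line => ¬ MeetIn X ℓ₁ ℓ₂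
  iseqv := ⟨fun _ => .refl, fun h => by
    induction h with
    | refl => exact .refl
    | tail _ h ih => exact .head (fun h' => h h'.symm) ih, .trans⟩

theorem cartan_apply (ℓ ℓ' : L.Line) [DecidablePred fun p : X => ℓ.HasPoint p.1 ∧ ℓ'.HasPoint p.1] :
    L.cartan X ℓ ℓ' =
      (Finset.univ.filter fun p : X => ℓ.HasPoint p.1 ∧ ℓ'.HasPoint p.1).card - 1 := by
  classical
  simp only [cartan, incidence, Matrix.sub_apply, Matrix.mul_apply, Matrix.transpose_apply,
    Matrix.of_apply]
  congr 1
  rw [Finset.card_filter]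
  push_cast
  refine Finset.sum_congr rfl fun p _ => ?_
  by_cases h1 : ℓ.HasPoint p.1 <;> by_cases h2 : ℓ'.HasPoint p.1 <;> simp [h1, h2]

theorem cartan_of_meetIn {ℓ ℓ' : L.Line} (hne : ℓ ≠ ℓ') (h : MeetIn X ℓ ℓ') :
    L.cartan X ℓ ℓ' = 0 := by
  classical
  obtain ⟨p, hp, h1, h2⟩ := h
  rw [cartan_apply, sub_eq_zero, Nat.cast_eq_one, Finset.card_eq_one]
  refine ⟨⟨p, hp⟩, ?_⟩
  ext q
  simp only [Finset.mem_filter, Finset.mem_univ, true_and, Finset.mem_singleton]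
  constructor
  · rintro ⟨h3, h4⟩
    exact Subtype.ext (hasPoint_unique hne h3 h4 h1 h2)
  · rintro rfl
    exact ⟨h1, h2⟩

theorem cartan_of_not_meetIn {ℓ ℓ' : L.Line} (h : ¬ MeetIn X ℓ ℓ') :
    L.cartan X ℓ ℓ' = -1 := by
  classical
  rw [cartan_apply, Finset.filter_false_of_mem]
  · simp
  · exact fun p _ hp => h ⟨p.1, p.2, hp⟩

/-- Off the diagonal an entry is 0 if the lines meet in `X` and -1 otherwise, so the graph of
nonzero entries is the relation whose components are the classes. -/
theorem connectedBlocks_cartan {κ : Type*} {c : L.Line → κ}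
    (hc : ∀ ℓ ℓ', c ℓ = c ℓ' ↔ (L.classSetoid X) ℓ ℓ') : ConnectedBlocks (L.cartan X) c where
  symm ℓ ℓ' := by
    classical
    simp only [cartan_apply, and_comm]
  nonpos ℓ ℓ' hne := by
    by_cases h : MeetIn X ℓ ℓ'
    · rw [cartan_of_meetIn hne h]
    · rw [cartan_of_not_meetIn h]
      norm_num
  block ℓ ℓ' hne := by
    refine cartan_of_meetIn (fun h => hne (congrArg c h)) ?_
    by_contra h
    exact hne ((hc ℓ ℓ').2 (.single h))
  conn ℓ ℓ' h := ((hc ℓ ℓ').1 h).lift id fun ℓ₁ ℓ₂ h h' => by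
    rw [id, id, cartan_of_not_meetIn h]
    norm_num

variable {K : Type*} [Field K]

theorem incidence_mulVec (x : L.Line → K) (p : X) :
    ((L.incidence X).map (Int.cast : ℤ → K)).mulVec x p = pointSum K p.1 x := by
  classical
  rw [pointSum_apply]
  refine Finset.sum_congr rfl fun ℓ _ => ?_
  change ((L.incidence X p ℓ : ℤ) : K) * x ℓ = _
  rw [incidence, Matrix.of_apply]
  split_ifs <;> simp

theorem cartan_map_eq (X : Finset (ℙ ℂ (Fin 3 → ℂ))) :
    (L.cartan X).map (Int.cast : ℤ → K) =
      ((L.incidence X).map (Int.cast : ℤ → K)).transpose *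
        (L.incidence X).map (Int.cast : ℤ → K) - Matrix.of fun _ _ => 1 := by
  ext ℓ ℓ'
  simp [cartan, Matrix.mul_apply]

theorem cartan_mulVec_of_pointSum {x : L.Line → K} (hx : ∀ p ∈ X, pointSum K p x = 0)
    (ℓ : L.Line) : ((L.cartan X).map (Int.cast : ℤ → K)).mulVec x ℓ = -∑ i, x i := by
  have h0 : ((L.incidence X).map (Int.cast : ℤ → K)).mulVec x = 0 := by
    ext p
    rw [incidence_mulVec, hx p.1 p.2]
    rfl
  rw [gram_mulVec (cartan_map_eq X), h0, Matrix.mulVec_zero]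
  simp

theorem cartan_mulVec_eq_mul {κ : Type*} {c : L.Line → κ}
    (hc : ∀ ℓ ℓ', c ℓ = c ℓ' ↔ (L.classSetoid X) ℓ ℓ') {x y : L.Line → K} {r : K} {ℓ : L.Line}
    (h : ∀ ℓ', c ℓ = c ℓ' → y ℓ' = r * x ℓ') :
    ((L.cartan X).map (Int.cast : ℤ → K)).mulVec y ℓ =
      r * ((L.cartan X).map (Int.cast : ℤ → K)).mulVec x ℓ := by
  simp only [Matrix.mulVec, dotProduct, Finset.mul_sum, Matrix.map_apply]
  refine Finset.sum_congr rfl fun ℓ' _ => ?_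
  by_cases hl : c ℓ = c ℓ'
  · rw [h ℓ' hl, mul_left_comm]
  · rw [(connectedBlocks_cartan hc).block ℓ ℓ' hl]
    simp

variable (L K) in
/-- The intersection of the kernels of `Q` and `E`. -/
def cartanKer (X : Finset (ℙ ℂ (Fin 3 → ℂ))) : Submodule K (L.Line → K) :=
  LinearMap.ker ((L.cartan X).map (Int.cast : ℤ → K)).mulVecLin ⊓
    LinearMap.ker (∑ ℓ : L.Line, LinearMap.proj ℓ : (L.Line → K) →ₗ[K] K)

theorem mem_cartanKer {x : L.Line → K} :
    x ∈ L.cartanKer K X ↔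
      ((L.cartan X).map (Int.cast : ℤ → K)).mulVec x = 0 ∧ ∑ ℓ, x ℓ = 0 := by
  simp [cartanKer]

/-! ### The pencil structure of the kernel -/

open Classical in
/-- The combinatorial data extracted from a resonant element: the classes are the components of
the relation of meeting outside `X`, and the multiplicities span the kernels of the blocks. -/
structure IsPencil {κ : Type*} (d : ℕ) (m : L.Line → ℕ+) (c : L.Line → κ)
    (X : Finset (ℙ ℂ (Fin 3 → ℂ))) : Prop where
  surjective : Function.Surjective c
  class_iff : ∀ ℓ ℓ', c ℓ = c ℓ' ↔ (L.classSetoid X) ℓ ℓ'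
  isMultiplePoint : ∀ p ∈ X, L.IsMultiplePoint p
  sum_class : ∀ i, ∑ ℓ with c ℓ = i, (m ℓ : ℕ) = d
  sum_point : ∀ p ∈ X, ∀ i j,
    ∑ ℓ with c ℓ = i ∧ ℓ.HasPoint p, (m ℓ : ℕ) = ∑ ℓ with c ℓ = j ∧ ℓ.HasPoint p, (m ℓ : ℕ)
  mulVec_eq_zero :
    ((L.cartan X).map (Int.cast : ℤ → ℚ)).mulVec (fun ℓ => ((m ℓ : ℕ) : ℚ)) = 0

namespace IsPencil

variable {κ κ' : Type*} {d : ℕ} {m : L.Line → ℕ+} {c : L.Line → κ}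

theorem congr (h : IsPencil d m c X) (e : κ ≃ κ') : IsPencil d m (e ∘ c) X where
  surjective := e.surjective.comp h.surjective
  class_iff ℓ ℓ' := e.injective.eq_iff.trans (h.class_iff ℓ ℓ')
  isMultiplePoint := h.isMultiplePoint
  sum_class i := by
    obtain ⟨i, rfl⟩ := e.surjective i
    convert h.sum_class i using 2
    ext ℓ
    simp
  sum_point p hp i j := by
    obtain ⟨i, rfl⟩ := e.surjective i
    obtain ⟨j, rfl⟩ := e.surjective j
    convert h.sum_point p hp i j using 2 <;> ext ℓ <;> simp
  mulVec_eq_zero := h.mulVec_eq_zero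

theorem connectedBlocks (h : IsPencil d m c X) : ConnectedBlocks (L.cartan X) c :=
  connectedBlocks_cartan h.class_iff

theorem meetIn (h : IsPencil d m c X) {ℓ ℓ' : L.Line} (hne : c ℓ ≠ c ℓ') : MeetIn X ℓ ℓ' := by
  by_contra hm
  exact hne ((h.class_iff ℓ ℓ').2 (.single hm))

theorem mulVec_natCast_eq_zero (h : IsPencil d m c X) (K : Type*) [Field K] [CharZero K] :
    ((L.cartan X).map (Int.cast : ℤ → K)).mulVec (fun ℓ => ((m ℓ : ℕ) : K)) = 0 := by
  ext ℓ
  have h1 := congrFun h.mulVec_eq_zero ℓ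
  simp only [Matrix.mulVec, dotProduct, Matrix.map_apply, Pi.zero_apply] at h1 ⊢
  exact_mod_cast h1

theorem pos [Nonempty κ] (h : IsPencil d m c X) : 0 < d := by
  classical
  obtain ⟨i⟩ := ‹Nonempty κ›
  obtain ⟨ℓ, hℓ⟩ := h.surjective i
  rw [← h.sum_class i]
  exact Finset.sum_pos (fun ℓ _ => (m ℓ).pos) ⟨ℓ, by simp [hℓ]⟩

theorem sum_mul [Fintype κ] (h : IsPencil d m c X) (r : κ → K) :
    ∑ ℓ, r (c ℓ) * (m ℓ : ℕ) = d * ∑ i, r i := by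
  classical
  rw [← Finset.sum_fiberwise Finset.univ c, Finset.mul_sum]
  refine Finset.sum_congr rfl fun i _ => ?_
  rw [← h.sum_class i, Nat.cast_sum, Finset.sum_mul]
  refine Finset.sum_congr rfl fun ℓ hℓ => ?_
  rw [(Finset.mem_filter.1 hℓ).2, mul_comm]

theorem pointSum_mul [Fintype κ] (h : IsPencil d m c X) {r : κ → K} (hr : ∑ i, r i = 0)
    {p : ℙ ℂ (Fin 3 → ℂ)} (hp : p ∈ X) : pointSum K p (fun ℓ => r (c ℓ) * (m ℓ : ℕ)) = 0 := by
  classical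
  rw [pointSum_apply, ← Finset.sum_fiberwise Finset.univ c]
  have h1 : ∀ i, ∑ ℓ with c ℓ = i, (if ℓ.HasPoint p then r (c ℓ) * ((m ℓ : ℕ) : K) else 0) =
      r i * ((∑ ℓ with c ℓ = i ∧ ℓ.HasPoint p, (m ℓ : ℕ) : ℕ) : K) := by
    intro i
    rw [← Finset.sum_filter, Finset.filter_filter, Nat.cast_sum, Finset.mul_sum]
    refine Finset.sum_congr rfl fun ℓ hℓ => ?_
    rw [(Finset.mem_filter.1 hℓ).2.1]
  rw [Finset.sum_congr rfl fun i _ => h1 i]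
  rcases isEmpty_or_nonempty κ with _ | ⟨⟨i⟩⟩
  · simp
  · have h2 : ∀ j, r j * ((∑ ℓ with c ℓ = j ∧ ℓ.HasPoint p, (m ℓ : ℕ) : ℕ) : K) =
        r j * ((∑ ℓ with c ℓ = i ∧ ℓ.HasPoint p, (m ℓ : ℕ) : ℕ) : K) := fun j => by
      rw [h.sum_point p hp j i]
    rw [Finset.sum_congr rfl fun j _ => h2 j, ← Finset.sum_mul, hr, zero_mul]

/-- On each class a kernel vector of `Q` is a multiple `r i` of `m`. Its total sum is `d * ∑ r i`,
and `d ≠ 0` in characteristic zero. -/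
theorem mem_cartanKer_iff [CharZero K] [Fintype κ] [Nonempty κ] (h : IsPencil d m c X)
    {x : L.Line → K} :
    x ∈ L.cartanKer K X ↔ ∃ r : κ → K, ∑ i, r i = 0 ∧ x = fun ℓ => r (c ℓ) * (m ℓ : ℕ) := by
  have hd : (d : K) ≠ 0 := Nat.cast_ne_zero.2 h.pos.ne'
  rw [mem_cartanKer]
  constructor
  · rintro ⟨hQ, hE⟩
    choose o ho using h.surjective
    have hx : x = fun ℓ => (x (o (c ℓ)) / (m (o (c ℓ)) : ℕ)) * (m ℓ : ℕ) := by
      ext ℓ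
      have h1 := h.connectedBlocks.mul_eq_mul_of_charZero h.mulVec_eq_zero hQ (ho (c ℓ)).symm
      have h2 : ((m (o (c ℓ)) : ℕ) : K) ≠ 0 := Nat.cast_ne_zero.2 (m _).pos.ne'
      rw [div_mul_eq_mul_div, eq_div_iff h2, h1]
    refine ⟨fun i => x (o i) / (m (o i) : ℕ), ?_, hx⟩
    rw [hx, h.sum_mul fun i => x (o i) / (m (o i) : ℕ)] at hE
    exact (mul_eq_zero.1 hE).resolve_left hd
  · rintro ⟨r, hr, rfl⟩
    refine ⟨?_, by rw [h.sum_mul, hr, mul_zero]⟩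
    ext ℓ
    rw [cartan_mulVec_eq_mul h.class_iff (x := fun ℓ => ((m ℓ : ℕ) : K)) (r := r (c ℓ))
      (fun ℓ' hl => by rw [hl]), h.mulVec_natCast_eq_zero, Pi.zero_apply, mul_zero]

theorem finrank_cartanKer [CharZero K] [Fintype κ] [Nonempty κ] (h : IsPencil d m c X) :
    Module.finrank K (L.cartanKer K X) + 1 = Fintype.card κ := by
  let φ : (κ → K) →ₗ[K] (L.Line → K) :=
    LinearMap.pi fun ℓ => ((m ℓ : ℕ) : K) • LinearMap.proj (c ℓ)
  have hφ : ∀ r, φ r = fun ℓ => r (c ℓ) * (m ℓ : ℕ) := fun r => by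
    ext ℓ
    simp [φ, mul_comm]
  have hinj : Function.Injective φ := by
    intro r s hrs
    ext i
    obtain ⟨ℓ, rfl⟩ := h.surjective i
    rw [hφ, hφ] at hrs
    exact mul_right_cancel₀ (Nat.cast_ne_zero.2 (m ℓ).pos.ne') (congrFun hrs ℓ)
  let s : Module.Dual K (κ → K) := ∑ i, LinearMap.proj i
  have hs : ∀ r, s r = ∑ i, r i := fun r => by simp [s]
  have hs0 : s ≠ 0 := by
    classical
    obtain ⟨i⟩ := ‹Nonempty κ›
    intro h0
    have := hs (Pi.single i 1)
    rw [h0] at this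
    simp at this
  have hmap : L.cartanKer K X = (LinearMap.ker s).map φ := by
    ext x
    rw [h.mem_cartanKer_iff, Submodule.mem_map]
    refine exists_congr fun r => and_congr ?_ ?_
    · rw [LinearMap.mem_ker, hs]
    · rw [hφ, eq_comm]
  rw [hmap, (Submodule.equivMapOfInjective φ hinj _).finrank_eq.symm,
    Module.Dual.finrank_ker_add_one_of_ne_zero hs0, Module.finrank_fintype_fun_eq_card]

/-- At a point of `X` both local sums vanish. All lines through a point outside `X` lie in one
class, where `x` and `y` are multiples of the same vector `m`. -/
theorem omega_mul_omega [CharZero K] [Fintype κ] [Nonempty κ] (h : IsPencil d m c X)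
    {x y : L.Line → K} (hx : x ∈ L.cartanKer K X) (hy : y ∈ L.cartanKer K X) :
    L.omega K x * L.omega K y = 0 := by
  classical
  obtain ⟨r, hr, rfl⟩ := h.mem_cartanKer_iff.1 hx
  obtain ⟨s, hs, rfl⟩ := h.mem_cartanKer_iff.1 hy
  refine omega_mul_omega_eq_zero fun p ℓ hℓ => ?_
  by_cases hp : p ∈ X
  · rw [h.pointSum_mul hr hp, h.pointSum_mul hs hp, zero_mul, zero_mul]
  · have hcl : ∀ ℓ' : L.Line, ℓ'.HasPoint p → c ℓ' = c ℓ := by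
      intro ℓ' hℓ'
      by_contra hne
      obtain ⟨q, hq, h1, h2⟩ := h.meetIn hne
      exact hp (hasPoint_unique (fun h => hne (congrArg c h)) hℓ' hℓ h1 h2 ▸ hq)
    rw [pointSum_apply, pointSum_apply, Finset.sum_mul, Finset.sum_mul]
    refine Finset.sum_congr rfl fun ℓ' _ => ?_
    split_ifs with hl
    · rw [hcl ℓ' hl]
      ring
    · simp

end IsPencil

/-! ### From resonant elements to pencils -/

variable (L) in
theorem finite_isMultiplePoint : {p | L.IsMultiplePoint p}.Finite := by
  classical
  choose! P hP using fun x : L.Line × L.Line => fun h : x.1 ≠ x.2 => exists_hasPoint h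
  refine (Set.finite_range P).subset fun p hp => ?_
  have hp : 3 ≤ {ℓ : L.Line | ℓ.HasPoint p}.ncard := hp
  obtain ⟨ℓ, ℓ', hℓ, hℓ', hne⟩ := (Set.one_lt_ncard_iff).1
    (by omega : 1 < {ℓ : L.Line | ℓ.HasPoint p}.ncard)
  have h := hP (ℓ, ℓ') hne
  exact ⟨(ℓ, ℓ'), hasPoint_unique hne h.1 h.2 hℓ hℓ'⟩

open Classical in
/-- The multiple points at which the coefficients of `a` sum up to zero. -/
def resonantPoints (a : L.Line → K) : Finset (ℙ ℂ (Fin 3 → ℂ)) :=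
  L.finite_isMultiplePoint.toFinset.filter fun p => pointSum K p a = 0

theorem mem_resonantPoints {a : L.Line → K} {p : ℙ ℂ (Fin 3 → ℂ)} :
    p ∈ resonantPoints a ↔ L.IsMultiplePoint p ∧ pointSum K p a = 0 := by
  simp [resonantPoints]

theorem pointSum_pair {p : ℙ ℂ (Fin 3 → ℂ)} (hp : ¬ L.IsMultiplePoint p) {ℓ ℓ' : L.Line}
    (hne : ℓ ≠ ℓ') (hℓ : ℓ.HasPoint p) (hℓ' : ℓ'.HasPoint p) (x : L.Line → K) :
    pointSum K p x = x ℓ + x ℓ' := by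
  classical
  have h1 : {ℓ, ℓ'} = {ℓ : L.Line | ℓ.HasPoint p} := by
    refine Set.eq_of_subset_of_ncard_le ?_ ?_
    · rintro _ (rfl | rfl) <;> assumption
    · rw [Set.ncard_pair hne]
      rw [IsMultiplePoint] at hp
      omega
  have h2 : (Finset.univ.filter fun ℓ : L.Line => ℓ.HasPoint p) = {ℓ, ℓ'} := by
    ext j
    have := Set.ext_iff.1 h1 j
    simpa using this.symm
  rw [pointSum_apply, ← Finset.sum_filter, h2, Finset.sum_pair hne]

/-! ### Consequences of a resonant element with no zero coordinate -/

section Resonant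

variable {a b : L.Line → K} (ha : ∀ ℓ, a ℓ ≠ 0) (hab : L.omega K a * L.omega K b = 0)

include ha hab

theorem pointSum_eq_zero_of_resonant {p : ℙ ℂ (Fin 3 → ℂ)} {ℓ : L.Line} (hℓ : ℓ.HasPoint p)
    (hp : pointSum K p a = 0) : pointSum K p b = 0 := by
  have h := eq_of_omega_mul_omega_eq_zero hab hℓ
  rw [hp, zero_mul] at h
  exact (mul_eq_zero.1 h.symm).resolve_right (ha ℓ)

theorem mul_eq_mul_of_resonant {ℓ ℓ' : L.Line} (h : ¬ MeetIn (resonantPoints a) ℓ ℓ') :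
    b ℓ * a ℓ' = b ℓ' * a ℓ := by
  by_cases hne : ℓ = ℓ'
  · rw [hne]
  obtain ⟨p, hp, hp'⟩ := exists_hasPoint hne
  -- If the sum at `p` is zero, then `p` is a double point, being outside the resonant points, and
  -- both coefficient pairs have the form `(t, -t)`.
  by_cases hs : pointSum K p a = 0
  · have hs' := pointSum_eq_zero_of_resonant ha hab hp hs
    have hpX : ¬ L.IsMultiplePoint p := fun hm => h ⟨p, mem_resonantPoints.2 ⟨hm, hs⟩, hp, hp'⟩
    rw [pointSum_pair hpX hne hp hp'] at hs hs'
    rw [eq_neg_of_add_eq_zero_right hs, eq_neg_of_add_eq_zero_right hs']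
    ring
  · have h1 := eq_of_omega_mul_omega_eq_zero hab hp
    have h2 := eq_of_omega_mul_omega_eq_zero hab hp'
    refine mul_left_cancel₀ hs ?_
    linear_combination a ℓ' * h1 - a ℓ * h2

theorem div_eq_div_of_resonant {ℓ ℓ' : L.Line} (h : (L.classSetoid (resonantPoints a)) ℓ ℓ') :
    b ℓ / a ℓ = b ℓ' / a ℓ' := by
  change Relation.ReflTransGen (fun ℓ₁ ℓ₂ : L.Line => ¬ MeetIn (resonantPoints a) ℓ₁ ℓ₂) ℓ ℓ' at h
  induction h with
  | refl => rfl
  | tail _ h ih =>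
    rw [ih, div_eq_div_iff (ha _) (ha _)]
    exact mul_eq_mul_of_resonant ha hab h

theorem mem_cartanKer_of_resonant (hb : b ∉ Submodule.span K {a}) :
    a ∈ L.cartanKer K (resonantPoints a) ∧ b ∈ L.cartanKer K (resonantPoints a) := by
  have hpt : ∀ p ∈ resonantPoints a, pointSum K p b = 0 := by
    intro p hp
    obtain ⟨hm, hs⟩ := mem_resonantPoints.1 hp
    have hm : 3 ≤ {ℓ : L.Line | ℓ.HasPoint p}.ncard := hm
    obtain ⟨ℓ, hℓ⟩ := Set.nonempty_of_ncard_ne_zero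
      (by omega : {ℓ : L.Line | ℓ.HasPoint p}.ncard ≠ 0)
    exact pointSum_eq_zero_of_resonant ha hab hℓ hs
  have hQa := cartan_mulVec_of_pointSum
    fun p (hp : p ∈ resonantPoints a) => (mem_resonantPoints.1 hp).2
  have hQb := cartan_mulVec_of_pointSum hpt
  -- Row `ℓ` of `Q` sees only the class of `ℓ`, where `b` is a constant multiple of `a`; and `Q`
  -- acts on both as minus the total sum. Were `∑ a` nonzero, this constant would be the same for
  -- all `ℓ` and `b` would be a multiple of `a`.
  have hEa : ∀ ℓ, ∑ i, b i = b ℓ / a ℓ * ∑ i, a i := by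
    intro ℓ
    have h1 := cartan_mulVec_eq_mul (X := resonantPoints a) (c := Quotient.mk (L.classSetoid _))
      (fun _ _ => Quotient.eq) (x := a) (y := b) (r := b ℓ / a ℓ) (ℓ := ℓ) fun ℓ' hl => by
        rw [div_eq_div_of_resonant ha hab (Quotient.eq.1 hl), div_mul_cancel₀ _ (ha _)]
    rw [hQa, hQb] at h1
    linear_combination -h1
  have hEa0 : ∑ i, a i = 0 := by
    by_contra h0
    refine hb (Submodule.mem_span_singleton.2 ⟨(∑ i, b i) / ∑ i, a i, ?_⟩)
    ext ℓ
    rw [hEa ℓ, mul_div_cancel_right₀ _ h0, Pi.smul_apply, smul_eq_mul, div_mul_cancel₀ _ (ha _)]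
  have hEb0 : ∑ i, b i = 0 := by
    rcases isEmpty_or_nonempty L.Line with _ | ⟨⟨ℓ⟩⟩
    · simp
    · rw [hEa ℓ, hEa0, mul_zero]
  rw [mem_cartanKer, mem_cartanKer]
  refine ⟨⟨?_, hEa0⟩, ⟨?_, hEb0⟩⟩
  · ext ℓ
    rw [hQa, hEa0, neg_zero, Pi.zero_apply]
  · ext ℓ
    rw [hQb, hEb0, neg_zero, Pi.zero_apply]

theorem nontrivial_quotient_of_resonant (hb : b ∉ Submodule.span K {a}) :
    Nontrivial (Quotient (L.classSetoid (resonantPoints a))) := by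
  by_contra hcon
  rw [not_nontrivial_iff_subsingleton] at hcon
  apply hb
  rcases isEmpty_or_nonempty L.Line with _ | ⟨⟨o⟩⟩
  · rw [Subsingleton.elim b 0]
    exact zero_mem _
  refine Submodule.mem_span_singleton.2 ⟨b o / a o, ?_⟩
  ext ℓ
  rw [div_eq_div_of_resonant ha hab
      (Quotient.eq.1 (Subsingleton.elim (Quotient.mk _ o) (Quotient.mk _ ℓ))),
    Pi.smul_apply, smul_eq_mul, div_mul_cancel₀ _ (ha _)]

theorem exists_isPencil_of_resonant [CharZero K] (hb : b ∉ Submodule.span K {a}) :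
    ∃ (d : ℕ) (m : L.Line → ℕ+),
      IsPencil d m (Quotient.mk (L.classSetoid (resonantPoints a))) (resonantPoints a) ∧
      Finset.univ.gcd (fun ℓ => (m ℓ : ℕ)) = 1 := by
  classical
  let X := resonantPoints a
  let c := Quotient.mk (L.classSetoid X)
  have hsurj : Function.Surjective c := Quotient.mk_surjective
  have hc : ∀ ℓ ℓ', c ℓ = c ℓ' ↔ (L.classSetoid X) ℓ ℓ' := fun _ _ => Quotient.eq
  have : Nontrivial (Quotient (L.classSetoid X)) := nontrivial_quotient_of_resonant ha hab hb
  obtain ⟨hQa, -⟩ := mem_cartanKer.1 (mem_cartanKer_of_resonant ha hab hb).1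
  have hu : ∀ k, ∃ u : L.Line → ℚ, ((L.cartan X).map (Int.cast : ℤ → ℚ)).mulVec u = 0 ∧
      ∃ i, c i = k ∧ u i ≠ 0 := by
    intro k
    obtain ⟨ℓ, rfl⟩ := hsurj k
    -- The functional is adapted to the class, so that the rational kernel vector `f ∘ a` is nonzero
    -- there.
    obtain ⟨f, hf⟩ : ∃ f : Module.Dual ℚ K, f (a ℓ) ≠ 0 := by
      by_contra! hcon
      exact ha ℓ ((Module.forall_dual_apply_eq_zero_iff ℚ _).1 hcon)
    refine ⟨fun ℓ => f (a ℓ), ?_, ℓ, rfl, hf⟩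
    rw [intMatrix_mulVec_dual, hQa]
    ext
    simp
  obtain ⟨v, hv0, hQv, hv1, hvJ⟩ :=
    (connectedBlocks_cartan hc).map_intCast.exists_pos_mulVec_eq_zero (cartan_map_eq X) hu
  have : Nonempty L.Line := ⟨(hsurj (Classical.arbitrary _)).choose⟩
  obtain ⟨t, m, ht, hvm, hgcd⟩ := exists_eq_mul_pnat v hv0
  -- Each class sum of `v = t m` is 1, so the class sums of `m` agree; their common value is `d`.
  have hsum : ∀ i, (∑ ℓ with c ℓ = i, (m ℓ : ℕ) : ℚ) = t⁻¹ := by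
    intro i
    have := hv1 i
    simp only [hvm, ← Finset.mul_sum] at this
    convert eq_inv_of_mul_eq_one_right this
  obtain ⟨o⟩ := ‹Nonempty L.Line›
  refine ⟨∑ ℓ with c ℓ = c o, (m ℓ : ℕ), m, ⟨hsurj, hc, fun p hp => (mem_resonantPoints.1 hp).1,
    fun i => ?_, fun p hp i j => ?_, ?_⟩, hgcd⟩
  · have := (hsum i).trans (hsum (c o)).symm
    convert (by exact_mod_cast this : ∑ ℓ with c ℓ = i, (m ℓ : ℕ) = ∑ ℓ with c ℓ = c o, (m ℓ : ℕ))
  · have := hvJ i j ⟨p, hp⟩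
    simp only [hvm, Matrix.map_apply, incidence, Matrix.of_apply, Int.cast_ite, Int.cast_one,
      Int.cast_zero, ite_mul, one_mul, zero_mul, ← Finset.sum_filter, Finset.filter_filter,
      ← Finset.mul_sum] at this
    exact_mod_cast mul_left_cancel₀ ht.ne' this
  · have h1 : v = t • fun ℓ => ((m ℓ : ℕ) : ℚ) := by
      ext ℓ
      exact hvm ℓ
    rw [h1, Matrix.mulVec_smul] at hQv
    exact (smul_eq_zero.1 hQv).resolve_left ht.ne'

/-- Any two elements of the kernel multiply to zero, so a nonresonant one would span the whole
kernel, which contains the independent vectors `a` and `b`. -/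
theorem cartanKer_subset_resonance [CharZero K] (hb : b ∉ Submodule.span K {a}) :
    (L.cartanKer K (resonantPoints a) : Set (L.Line → K)) ⊆ L.resonance K := by
  classical
  obtain ⟨d, m, hp, -⟩ := exists_isPencil_of_resonant ha hab hb
  obtain ⟨haV, hbV⟩ := mem_cartanKer_of_resonant ha hab hb
  have := nontrivial_quotient_of_resonant ha hab hb
  have := Fintype.ofFinite (Quotient (L.classSetoid (resonantPoints a)))
  intro x hx
  by_contra hcon
  have hle : ∀ y ∈ L.cartanKer K (resonantPoints a), y ∈ Submodule.span K {x} := by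
    intro y hy
    by_contra hyx
    exact hcon ⟨y, hyx, hp.omega_mul_omega hx hy⟩
  obtain ⟨r, hr⟩ := Submodule.mem_span_singleton.1 (hle a haV)
  obtain ⟨s, hs⟩ := Submodule.mem_span_singleton.1 (hle b hbV)
  have hr0 : r ≠ 0 := by
    rintro rfl
    obtain ⟨o, -⟩ := hp.surjective (Classical.arbitrary _)
    refine ha o ?_
    rw [← hr, zero_smul, Pi.zero_apply]
  refine hb (Submodule.mem_span_singleton.2 ⟨s * r⁻¹, ?_⟩)
  rw [← hr, ← hs, smul_smul, inv_mul_cancel_right₀ hr0]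

theorem two_le_finrank_cartanKer (hb : b ∉ Submodule.span K {a}) :
    2 ≤ Module.finrank K (L.cartanKer K (resonantPoints a)) := by
  obtain ⟨haV, hbV⟩ := mem_cartanKer_of_resonant ha hab hb
  have ha0 : a ≠ 0 := by
    rintro rfl
    rcases isEmpty_or_nonempty L.Line with _ | ⟨⟨o⟩⟩
    · exact hb (by rw [Subsingleton.elim b 0]; exact zero_mem _)
    · exact ha o rfl
  have hlt : Submodule.span K {a} < L.cartanKer K (resonantPoints a) :=
    lt_of_le_of_ne ((Submodule.span_singleton_le_iff_mem _ _).2 haV) fun h => hb (h ▸ hbV)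
  have := Submodule.finrank_lt_finrank_of_lt hlt
  rwa [finrank_span_singleton ha0] at this

end Resonant

/-- A global resonance component is the intersection of the kernels of `Q` and `E`, for the
resonant points of an element without zero coefficients. -/
theorem IsGlobalResonanceComponent.exists_eq_cartanKer [CharZero K] {R : Set (L.Line → K)}
    (hR : L.IsGlobalResonanceComponent K R) :
    ∃ a b : L.Line → K, (∀ ℓ, a ℓ ≠ 0) ∧ b ∉ Submodule.span K {a} ∧
      L.omega K a * L.omega K b = 0 ∧ R = L.cartanKer K (resonantPoints a) := by
  classical
  let := zariskiTopology L.Line K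
  obtain ⟨⟨⟨hirr, hsub⟩, hmax⟩, hcoord⟩ := hR
  let S : Set (L.Line → K) := {a | (∀ ℓ, a ℓ ≠ 0) ∧ a ∈ L.resonance K}
  -- Only finitely many sets of resonant points occur, as all are subsets of the finite set of
  -- multiple points.
  have hfin : (resonantPoints '' S).Finite :=
    L.finite_isMultiplePoint.toFinset.powerset.finite_toSet.subset <| by
      rintro _ ⟨a, -, rfl⟩
      exact Finset.mem_coe.2 (Finset.mem_powerset.2 (Finset.filter_subset _ _))
  let T : Finset (Set (L.Line → K)) :=
    hfin.toFinset.image (fun X => (L.cartanKer K X : Set (L.Line → K))) ∪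
      Finset.univ.image (fun ℓ : L.Line => {a : L.Line → K | a ℓ = 0})
  have hT : ∀ Z ∈ T, IsClosed Z := by
    intro Z hZ
    rcases Finset.mem_union.1 hZ with hZ | hZ
    · obtain ⟨X, -, rfl⟩ := Finset.mem_image.1 hZ
      exact zariski_isClosed_submodule _
    · obtain ⟨ℓ, -, rfl⟩ := Finset.mem_image.1 hZ
      simpa using zariski_isClosed_zeroLocus (MvPolynomial.X ℓ : MvPolynomial L.Line K)
  have hcover : R ⊆ ⋃₀ (T : Set (Set (L.Line → K))) := by
    intro a haR
    by_cases ha : ∀ ℓ, a ℓ ≠ 0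
    · obtain ⟨b, hb, hab⟩ := hsub haR
      refine ⟨L.cartanKer K (resonantPoints a), ?_, (mem_cartanKer_of_resonant ha hab hb).1⟩
      refine Finset.mem_coe.2 (Finset.mem_union_left _ (Finset.mem_image_of_mem _ ?_))
      exact hfin.mem_toFinset.2 ⟨a, ⟨ha, hsub haR⟩, rfl⟩
    · push Not at ha
      obtain ⟨ℓ, hℓ⟩ := ha
      exact ⟨{a | a ℓ = 0}, Finset.mem_coe.2 (Finset.mem_union_right _
        (Finset.mem_image_of_mem _ (Finset.mem_univ ℓ))), hℓ⟩
  -- Irreducibility puts `R` inside a single kernel or coordinate hyperplane; hyperplanes are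
  -- excluded, and maximality turns the inclusion into equality.
  obtain ⟨Z, hZ, hRZ⟩ := isIrreducible_iff_sUnion_isClosed.1 hirr T hT hcover
  rcases Finset.mem_union.1 hZ with hZ | hZ
  · obtain ⟨X, hX, rfl⟩ := Finset.mem_image.1 hZ
    obtain ⟨a, ⟨ha, b, hb, hab⟩, rfl⟩ := hfin.mem_toFinset.1 hX
    refine ⟨a, b, ha, hb, hab, hRZ.antisymm ?_⟩
    exact hmax ⟨zariski_isIrreducible_submodule _, cartanKer_subset_resonance ha hab hb⟩ hRZ
  · obtain ⟨ℓ, -, rfl⟩ := Finset.mem_image.1 hZ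
    exact (hcoord ℓ hRZ).elim

theorem IsPencil.isMultinet {k d : ℕ} {m : L.Line → ℕ+} {c : L.Line → Fin k}
    (h : IsPencil d m c X) (hk : 3 ≤ k) : IsMultinet k d m c X where
  three_le := hk
  classes_nonempty := h.surjective
  isMultiplePoint := h.isMultiplePoint
  sum_class i := by convert h.sum_class i
  meetIn ℓ ℓ' := h.meetIn
  sum_point p hp i j := by convert h.sum_point p hp i j
  connected ℓ ℓ' hl := (h.class_iff ℓ ℓ').1 hl

end LineArrangement

end

/-! ### Counting the classes and assembling the theorem -/

theorem theorem2p5 (L : LineArrangement) (K : Type*) [Field K] [CharZero K] (k : ℕ)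
    (R : Set (L.Line → K)) (hR : L.IsGlobalResonanceComponent K R)
    (hdim : zariskiDim R + 1 = k) :
    ∃ (d : ℕ) (m : L.Line → ℕ+) (c : L.Line → Fin k) (X : Finset (ℙ ℂ (Fin 3 → ℂ))),
      -- `L` supports a `(k,d)`-multinet
      LineArrangement.IsMultinet k d m c X ∧
      -- the multiplicities are mutually relatively prime
      Finset.univ.gcd (fun ℓ => (m ℓ : ℕ)) = 1 ∧
      -- `R` is the intersection of the kernels of `Q` and `E`
      R = {a | ((L.cartan X).map (Int.cast : ℤ → K)).mulVec a = 0 ∧ ∑ ℓ, a ℓ = 0} ∧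
      -- `Q` is the direct sum of its blocks on the classes
      (∀ ℓ ℓ', c ℓ ≠ c ℓ' → L.cartan X ℓ ℓ' = 0) ∧
      -- these are indecomposable of affine type, with kernel spanned by the multiplicity vector
      (∀ i, IsAffineCartan (LineArrangement.cartanBlock X c i) ∧
        LinearMap.ker (LineArrangement.cartanBlock X c i).mulVecLin =
          Submodule.span ℝ {fun ℓ => ((m ℓ.1 : ℕ) : ℝ)}) := by
  classical
  obtain ⟨a, b, ha, hb, hab, rfl⟩ := hR.exists_eq_cartanKer
  obtain ⟨d, m, hp, hgcd⟩ := LineArrangement.exists_isPencil_of_resonant ha hab hb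
  have := LineArrangement.nontrivial_quotient_of_resonant ha hab hb
  have := Fintype.ofFinite (Quotient (L.classSetoid (LineArrangement.resonantPoints a)))
  have hrank := hp.finrank_cartanKer (K := K)
  have h2 := LineArrangement.two_le_finrank_cartanKer ha hab hb
  rw [zariskiDim_submodule] at hdim
  have hk : Fintype.card (Quotient (L.classSetoid (LineArrangement.resonantPoints a))) = k := by
    rw [← hrank]
    exact_mod_cast hdim
  have hp' := hp.congr (Fintype.equivFinOfCardEq hk)
  -- The bound `3 ≤ k` holds because the kernel has rank `k - 1` and contains two independent
  -- vectors.
  refine ⟨d, m, _, _, hp'.isMultinet (by omega), hgcd, ?_, hp'.connectedBlocks.block, fun i => ?_⟩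
  · ext x
    exact LineArrangement.mem_cartanKer
  · exact hp'.connectedBlocks.map_intCast.isAffineCartan (m := fun ℓ => ((m ℓ : ℕ) : ℝ))
      (fun ℓ => Nat.cast_pos.2 (m ℓ).pos) (hp'.mulVec_natCast_eq_zero ℝ) i (hp'.surjective i)
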